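/- **Parity decision trees.** A (deterministic) parity decision tree over $\mathbb F_2^n$ is a finite rooted binary tree in which every internal node $v$ is labelled by a vector $y_v\in\mathbb F_2^n$ and every leaf by a bit. On input $x\in\mathbb F_2^n$ one walks from the root, going at $v$ to the left child if $\langle x,y_v\rangle=0$ and to the right child if $\langle x,y_v\rangle=1$ (inner product over $\mathbb F_2$), and outputs the label of the leaf reached. The size of the tree is its total number of nodes. A randomized parity decision tree is a probability distribution $\nu$ over deterministic ones; it decides a predicate $P\colon\mathbb F_2^n\to\{0,1\}$ with error $\delta$ if for every fixed $x$ a tree sampled from $\nu$ outputs $P(x)$ with probability at least $1-\delta$. Its size is the supremum of the sizes of the trees in the support of $\nu$; its average size is the expected size of a tree sampled from $\nu$. **Theorem 6.** For every constant $\delta_1<1/2$ there is a constant $c>0$, depending only on $\delta_1$, such that the following holds for all integers $n\ge 0$, $k\ge 1$ and all reals $0<\delta\le\delta_1$ with $k^2<\delta n$: every randomized parity decision tree that decides with error $\delta$ whether the Hamming weight of $x\in\mathbb F_2^n$ equals exactly $k$ has size at least $\exp\bigl(c\,k\log(k/\delta)\bigr)$. The same lower bound holds for its average size. -/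

import Mathlib

open scoped ENNReal

/-- Deterministic parity decision trees over `𝔽₂ⁿ`. Leaves carry the output bit; an internal node
carries the vector `y` of the measurement `⟨x, y⟩`, then its left and its right child. -/
inductive ParityTree (n : ℕ) : Type
  | leaf (b : Bool) : ParityTree n
  | node (y : Fin n → ZMod 2) (left right : ParityTree n) : ParityTree n

namespace ParityTree

/-- The output on `x`: go left if `⟨x, y⟩ = 0` and right if `⟨x, y⟩ = 1`. -/
def eval {n : ℕ} : ParityTree n → (Fin n → ZMod 2) → Bool
  | leaf b, _ => b
  | node y l r, x => if dotProduct x y = 0 then l.eval x else r.eval x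

/-- The size: the total number of nodes, leaves included. -/
def size {n : ℕ} : ParityTree n → ℕ
  | leaf _ => 1
  | node _ l r => l.size + r.size + 1

end ParityTree

/-- A randomized parity decision tree is a probability distribution over deterministic ones
(there are only countably many of these). -/
abbrev RandomizedParityTree (n : ℕ) : Type := PMF (ParityTree n)

namespace RandomizedParityTree

/-- `ν` decides `P` with error `δ`: for every fixed input `x`, the output of a tree sampled
from `ν` equals `P x` with probability at least `1 - δ`. -/
def DecidesWithError {n : ℕ} (ν : RandomizedParityTree n) (δ : ℝ)
    (P : (Fin n → ZMod 2) → Bool) : Prop :=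
  ∀ x : Fin n → ZMod 2, ENNReal.ofReal (1 - δ) ≤ (PMF.map (fun T => T.eval x) ν) (P x)

/-- The (worst-case) size: the supremum of the sizes of the trees in the support. -/
noncomputable def maxSize {n : ℕ} (ν : RandomizedParityTree n) : ℝ≥0∞ :=
  ⨆ T ∈ PMF.support ν, (T.size : ℝ≥0∞)

/-- The average size of a tree sampled from `ν`. -/
noncomputable def expectedSize {n : ℕ} (ν : RandomizedParityTree n) : ℝ≥0∞ :=
  ∑' T : ParityTree n, ν T * (T.size : ℝ≥0∞)

end RandomizedParityTree

/-- The predicate on `𝔽₂ⁿ` that holds iff the Hamming weight of the input is exactly `k`. -/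
def hammingWeightEq (n k : ℕ) (x : Fin n → ZMod 2) : Bool :=
  decide (hammingNorm x = k)

/-!
The probability `f x` that a random tree accepts `x` is a combination, with nonnegative
coefficients, of indicators of affine subspaces (one for each accepting leaf), and the sum `W` of
the coefficients is at most the average size (`RandomizedParityTree.exists_hasAffineWeight`). The
powers `f ^ r` are such combinations with coefficient sum `W ^ r`, since affine subspaces are closed
under intersection. So it suffices to bound `W` from below for a function that is large on the
sphere of radius `k` and small elsewhere (`HasAffineWeight.sphere_bound`).

Start a random walk on the hypercube at a point of weight `k - t`, flipping a random coordinate at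
each step. As `k ^ 2 < δ n`, it rarely flips a coordinate twice, so that after `t` steps it is on
the sphere and after `t - 2` or `t + 2` steps it is not. For an affine subspace `A`, let `m j` be
the probability that the walk is in `A` after `j` steps. Modulo the direction of `A` this is an
entry of a power of a symmetric matrix, and the main point is the near log-convexity
`heat_near_log_convex`: unless `m t ^ 2 ≤ 9 m (t + 2) m (t - 2)`, one has
`m (t + 2) ≥ √t m t ^ (1 + 2 / t)`. Subspaces of the first kind can carry only a small part of
`∑ m t`, by Cauchy-Schwarz. By Hölder's inequality those of the second kind need a total
coefficient of about `(√t / error) ^ (t / 2)` (`HasAffineWeight.le_of_overlap_le`).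

For the near log-convexity, extend the bridge (the walk conditioned on its end points) of length
`t` by a step back and forth inserted after time `i`. The relative entropies of the extended
bridges, for `i < t`, telescope: their mean is `-(1 + 2 / t) log (m t)`
(`relEntropy_insertDensity`). If the positions of the bridge at times `j - 1` and `j + 1` overlap
for some `j`, exchanging the parts of two bridges gives the first alternative (`sq_le_of_overlap`).
Otherwise the time `i` of the insertion can be read off the extended path by bisection, and mixing
over `t = 2 ^ s` values of `i` lowers the relative entropy by a multiple of `log t`
(`dyadicMean_bounds`). The relative entropy is at least `-log (m (t + 2))`, which is the second
alternative.

For small `δ` this is applied to `f` with `t` close to `k`. Otherwise it is applied to a power of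
`f`, which improves the ratio of the values on and off the sphere, with `t` a small multiple of `k`;
for bounded `k` it is enough that the tree is not constant, so that the average size stays away
from `1`.
-/

/-! ### Relative entropy of mixtures -/

/-- The relative entropy (Kullback-Leibler divergence) `∑ w q log q` of the measure with density `q`
with respect to the weight `w`. -/
noncomputable def relEntropy {Ω : Type*} [Fintype Ω] (w q : Ω → ℝ) : ℝ :=
  ∑ y, w y * (q y * Real.log (q y))

/-- The pointwise form of the bound on mixtures; the error term sums to the Bhattacharyya
coefficient. -/
theorem mul_log_add_le {p q : ℝ} (hp : 0 ≤ p) (hq : 0 ≤ q) :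
    p * Real.log (p + q) ≤ p * Real.log p + √(p * q) := by
  rcases hp.eq_or_lt with rfl | hp
  · simp
  have hs : 0 ≤ √(p * q) := Real.sqrt_nonneg _
  have hss : √(p * q) ^ 2 = p * q := Real.sq_sqrt (by positivity)
  -- `log (1 + x ^ 2) ≤ x`, applied to `x = √(q / p)`
  have hx : 0 ≤ √(p * q) / p := by positivity
  have h1 : p + q = p * (1 + (√(p * q) / p) ^ 2) := by
    rw [div_pow, hss]; field_simp
  have h2 : Real.log (1 + (√(p * q) / p) ^ 2) ≤ √(p * q) / p := by
    rw [Real.log_le_iff_le_exp (by positivity)]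
    have h3 := Real.quadratic_le_exp_of_nonneg hx
    have h4 := Real.sum_le_exp_of_nonneg hx 4
    simp only [Finset.sum_range_succ, Finset.sum_range_zero, Nat.factorial] at h4
    norm_num at h4
    nlinarith [mul_nonneg hx (sq_nonneg (√(p * q) / p - 3 / 2))]
  rw [h1, Real.log_mul hp.ne' (by positivity), mul_add]
  have := mul_le_mul_of_nonneg_left h2 hp.le
  rw [mul_div_cancel₀ _ hp.ne'] at this
  linarith

/-- Mixing two densities with little overlap lowers the relative entropy by almost `log 2`. -/
theorem relEntropy_midpoint_le {Ω : Type*} [Fintype Ω] {w p q : Ω → ℝ}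
    (hw : ∀ y, 0 ≤ w y) (hp : ∀ y, 0 ≤ p y) (hq : ∀ y, 0 ≤ q y)
    (hp1 : ∑ y, w y * p y = 1) (hq1 : ∑ y, w y * q y = 1) :
    relEntropy w (fun y => (p y + q y) / 2) ≤
      (relEntropy w p + relEntropy w q) / 2 - Real.log 2 + ∑ y, √((w y * p y) * (w y * q y)) := by
  have key : ∀ y, w y * ((p y + q y) / 2 * Real.log ((p y + q y) / 2)) ≤
      (w y * (p y * Real.log (p y)) + w y * (q y * Real.log (q y))) / 2
        - (w y * p y + w y * q y) / 2 * Real.log 2 + √((w y * p y) * (w y * q y)) := by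
    intro y
    have e : √((w y * p y) * (w y * q y)) = w y * √(p y * q y) := by
      rw [show (w y * p y) * (w y * q y) = w y ^ 2 * (p y * q y) by ring,
        Real.sqrt_mul (by positivity), Real.sqrt_sq (hw y)]
    rw [e]
    have h1 := mul_log_add_le (hp y) (hq y)
    have h2 := mul_log_add_le (hq y) (hp y)
    rw [add_comm (q y), mul_comm (q y) (p y)] at h2
    have h3 : (p y + q y) / 2 * Real.log ((p y + q y) / 2) =
        (p y + q y) / 2 * Real.log (p y + q y) - (p y + q y) / 2 * Real.log 2 := by
      rcases (add_nonneg (hp y) (hq y)).eq_or_lt with h | h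
      · simp [← h]
      · rw [Real.log_div h.ne' (by norm_num)]; ring
    rw [h3]
    nlinarith [hw y]
  calc _ ≤ ∑ y, _ := Finset.sum_le_sum fun y _ => key y
    _ = _ := by
      rw [Finset.sum_add_distrib, Finset.sum_sub_distrib, ← Finset.sum_div,
        Finset.sum_add_distrib, ← Finset.sum_mul, ← Finset.sum_div, Finset.sum_add_distrib,
        hp1, hq1, relEntropy, relEntropy]
      ring

/-- Jensen's inequality: a relative entropy bounded above forces the total weight to be large. -/
theorem neg_log_sum_le_relEntropy {Ω : Type*} [Fintype Ω] {w q : Ω → ℝ}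
    (hw : ∀ y, 0 ≤ w y) (hq : ∀ y, 0 ≤ q y) (hq1 : ∑ y, w y * q y = 1) :
    0 < ∑ y, w y ∧ - Real.log (∑ y, w y) ≤ relEntropy w q := by
  have hM : 0 < ∑ y, w y := by
    refine (Finset.sum_nonneg fun y _ => hw y).lt_of_ne fun h => ?_
    have h0 := (Finset.sum_eq_zero_iff_of_nonneg fun y _ => hw y).1 h.symm
    rw [Finset.sum_eq_zero fun y hy => by rw [h0 y hy, zero_mul]] at hq1
    exact zero_ne_one hq1
  refine ⟨hM, ?_⟩
  set M := ∑ y, w y with hMd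
  have key : ∀ y, w y * q y * (1 - Real.log M) - w y / M ≤ w y * (q y * Real.log (q y)) := by
    intro y
    have : q y * (1 - Real.log M) - 1 / M ≤ q y * Real.log (q y) := by
      rcases (hq y).eq_or_lt with h | h
      · rw [← h]; simp [hM.le]
      · have h1 := Real.one_sub_inv_le_log_of_pos (mul_pos h hM)
        rw [Real.log_mul h.ne' hM.ne'] at h1
        have h2 := mul_le_mul_of_nonneg_left h1 h.le
        have h3 : q y * (1 - (q y * M)⁻¹) = q y - 1 / M := by field_simp
        rw [h3] at h2
        linarith
    have := mul_le_mul_of_nonneg_left this (hw y)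
    calc _ = w y * (q y * (1 - Real.log M) - 1 / M) := by ring
      _ ≤ _ := this
  have := Finset.sum_le_sum fun y (_ : y ∈ Finset.univ) => key y
  rw [Finset.sum_sub_distrib, ← Finset.sum_mul, ← Finset.sum_div, hq1, ← hMd,
    div_self hM.ne'] at this
  unfold relEntropy
  linarith

/-- Data processing for the Bhattacharyya coefficient. -/
theorem sum_sqrt_mul_le_sum_fiber {Ω Z : Type*} [Fintype Ω] [Fintype Z] [DecidableEq Z]
    (Y : Ω → Z) {p q : Ω → ℝ} (hp : ∀ y, 0 ≤ p y) (hq : ∀ y, 0 ≤ q y) :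
    ∑ y, √(p y * q y) ≤
      ∑ z, √((∑ y, p y * if Y y = z then 1 else 0) * (∑ y, q y * if Y y = z then 1 else 0)) := by
  rw [← Finset.sum_fiberwise Finset.univ Y]
  refine Finset.sum_le_sum fun z _ => ?_
  have e : ∀ p : Ω → ℝ, (∑ y, p y * if Y y = z then (1 : ℝ) else 0)
      = ∑ y with Y y = z, p y := by
    intro p
    rw [Finset.sum_filter]
    exact Finset.sum_congr rfl fun y _ => by split_ifs <;> simp
  rw [e, e, Real.sqrt_mul (Finset.sum_nonneg fun y _ => hp y)]
  calc _ = ∑ y with Y y = z, √(p y) * √(q y) :=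
        Finset.sum_congr rfl fun y _ => Real.sqrt_mul (hp y) _
    _ ≤ _ := Real.sum_sqrt_mul_sqrt_le _ hp hq

/-- The average of the densities `q p, …, q (p + 2 ^ s - 1)`, formed by repeated halving. -/
noncomputable def dyadicMean {Ω : Type*} (q : ℕ → Ω → ℝ) : ℕ → ℕ → Ω → ℝ
  | 0, p => q p
  | s + 1, p => fun y => (dyadicMean q s p y + dyadicMean q s (p + 2 ^ s) y) / 2

/-- Suppose that the density `q i` gives the coordinate `Y j` the law `π j` when `j ≤ i + 1` and
the law `π (j - 2)` when `j ≥ i + 2`. If `π (j - 1)` and `π (j + 1)` overlap by at most `η`, then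
`Y (j + 1)` tells whether `i < j` or `i ≥ j`; finding `i` by bisection shows that the mixture of
`2 ^ s` of these densities has a relative entropy lower by `s (log 2 - η)` than their mean. -/
theorem dyadicMean_bounds {Ω Z : Type*} [Fintype Ω] [Fintype Z] [DecidableEq Z] {w : Ω → ℝ}
    (hw : ∀ y, 0 ≤ w y) {q : ℕ → Ω → ℝ} {N : ℕ} (hq : ∀ i < N, ∀ y, 0 ≤ q i y)
    (hq1 : ∀ i < N, ∑ y, w y * q i y = 1) (Y : ℕ → Ω → Z) (π : ℕ → Z → ℝ)
    (hl : ∀ i < N, ∀ j ≤ i + 1, ∀ z, ∑ y, w y * q i y * (if Y j y = z then 1 else 0) = π j z)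
    (hr : ∀ i < N, ∀ j, i + 2 ≤ j → j ≤ N → ∀ z,
      ∑ y, w y * q i y * (if Y j y = z then 1 else 0) = π (j - 2) z)
    {η : ℝ} (hη : ∀ j, 1 ≤ j → j < N → ∑ z, √(π (j - 1) z * π (j + 1) z) ≤ η) :
    ∀ s p, p + 2 ^ s ≤ N →
      (∀ y, 0 ≤ dyadicMean q s p y) ∧ (∑ y, w y * dyadicMean q s p y = 1) ∧
      (∀ j ≤ p + 1, ∀ z,
        ∑ y, w y * dyadicMean q s p y * (if Y j y = z then 1 else 0) = π j z) ∧
      (∀ j, p + 2 ^ s + 1 ≤ j → j ≤ N → ∀ z,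
        ∑ y, w y * dyadicMean q s p y * (if Y j y = z then 1 else 0) = π (j - 2) z) ∧
      relEntropy w (dyadicMean q s p) ≤
        (∑ i ∈ Finset.range (2 ^ s), relEntropy w (q (p + i))) / 2 ^ s - s * (Real.log 2 - η) := by
  intro s
  induction s with
  | zero =>
    intro p hp
    simp only [pow_zero] at hp
    refine ⟨hq p (by omega), hq1 p (by omega), hl p (by omega),
      fun j hj hj' => hr p (by omega) j (by simp at hj; omega) hj', ?_⟩
    simp [dyadicMean]
  | succ s ih =>
    intro p hp
    have h2 : 2 ^ (s + 1) = 2 ^ s + 2 ^ s := by ring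
    have hpos : 0 < 2 ^ s := by positivity
    rw [h2] at hp
    obtain ⟨a0, a1, al, ar, ae⟩ := ih p (by omega)
    obtain ⟨b0, b1, bl, br, be⟩ := ih (p + 2 ^ s) (by omega)
    have lin : ∀ g : Ω → ℝ, ∑ y, w y * dyadicMean q (s + 1) p y * g y =
        (∑ y, w y * dyadicMean q s p y * g y
          + ∑ y, w y * dyadicMean q s (p + 2 ^ s) y * g y) / 2 := by
      intro g
      rw [← Finset.sum_add_distrib, Finset.sum_div]
      refine Finset.sum_congr rfl fun y _ => ?_
      simp only [dyadicMean]; ring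
    refine ⟨fun y => ?_, ?_, fun j hj z => ?_, fun j hj hj' z => ?_, ?_⟩
    · simp only [dyadicMean]
      linarith [a0 y, b0 y]
    · have := lin 1
      simp only [Pi.one_apply, mul_one] at this
      rw [this, a1, b1]; norm_num
    · rw [lin, al j hj, bl j (by omega)]; ring
    · rw [h2] at hj
      rw [lin, ar j (by omega) hj', br j (by omega) hj']; ring
    · have h := relEntropy_midpoint_le hw a0 b0 a1 b1
      by_cases hN : p + 2 ^ s + 1 ≤ N
      swap
      · omega
      have hbc := sum_sqrt_mul_le_sum_fiber (Y (p + 2 ^ s + 1))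
        (fun y => mul_nonneg (hw y) (a0 y)) (fun y => mul_nonneg (hw y) (b0 y))
      simp only [ar (p + 2 ^ s + 1) le_rfl hN, bl (p + 2 ^ s + 1) le_rfl] at hbc
      have hη' := hη (p + 2 ^ s) (by omega) (by omega)
      have e : p + 2 ^ s + 1 - 2 = p + 2 ^ s - 1 := by omega
      rw [e] at hbc
      have hsum : (∑ i ∈ Finset.range (2 ^ (s + 1)), relEntropy w (q (p + i))) =
          ∑ i ∈ Finset.range (2 ^ s), relEntropy w (q (p + i)) +
          ∑ i ∈ Finset.range (2 ^ s), relEntropy w (q (p + 2 ^ s + i)) := by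
        rw [h2, Finset.sum_range_add]
        simp only [add_assoc]
      have hd : relEntropy w (dyadicMean q (s + 1) p) =
        relEntropy w (fun y => (dyadicMean q s p y + dyadicMean q s (p + 2 ^ s) y) / 2) := rfl
      rw [hsum, hd, pow_succ, ← div_div, add_div, add_div]
      push_cast
      rw [add_div] at h
      linarith

/-! ### Weights of paths -/

/-- The ordered product `K s * K (s + 1) * ⋯ * K (s + l - 1)`. -/
def segProd {G : Type*} [Fintype G] [DecidableEq G] (K : ℕ → Matrix G G ℝ) (s : ℕ) :
    ℕ → Matrix G G ℝ
  | 0 => 1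
  | l + 1 => segProd K s l * K (s + l)

theorem segProd_add {G : Type*} [Fintype G] [DecidableEq G] (K : ℕ → Matrix G G ℝ) (s l l' : ℕ) :
    segProd K s (l + l') = segProd K s l * segProd K (s + l) l' := by
  induction l' with
  | zero => simp [segProd]
  | succ l' ih => rw [← add_assoc, segProd, ih, segProd, Matrix.mul_assoc, add_assoc]

theorem segProd_one {G : Type*} [Fintype G] [DecidableEq G] (K : ℕ → Matrix G G ℝ) (s : ℕ) :
    segProd K s 1 = K s := by
  simp [segProd]

theorem segProd_eq_pow {G : Type*} [Fintype G] [DecidableEq G] {K : ℕ → Matrix G G ℝ}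
    {S : Matrix G G ℝ} {s l : ℕ} (h : ∀ j, s ≤ j → j < s + l → K j = S) :
    segProd K s l = S ^ l := by
  induction l with
  | zero => simp [segProd]
  | succ l ih =>
    rw [segProd, ih fun j h1 h2 => h j h1 (by omega), h _ (by omega) (by omega), pow_succ]

/-- The position at time `j` of a path with `T` steps (its end point when `j > T`). -/
def pathAt {G : Type*} {T : ℕ} (j : ℕ) (y : Fin (T + 1) → G) : G :=
  y ⟨min j T, by omega⟩

/-- The weight of a path from `a` to `b` whose `l`-th step is weighted by `K l`. -/
def pathWeight {G : Type*} [DecidableEq G] (K : ℕ → Matrix G G ℝ) (a b : G) (T : ℕ)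
    (y : Fin (T + 1) → G) : ℝ :=
  (if pathAt 0 y = a then 1 else 0) *
    (∏ l ∈ Finset.range T, K l (pathAt l y) (pathAt (l + 1) y)) *
    (if pathAt T y = b then 1 else 0)

theorem sum_pathWeight {G : Type*} [Fintype G] [DecidableEq G] (K : ℕ → Matrix G G ℝ) (a b : G)
    (T : ℕ) : ∑ y, pathWeight K a b T y = segProd K 0 T a b := by
  induction T generalizing b with
  | zero =>
    simp only [pathWeight, pathAt, Finset.range_zero, Finset.prod_empty, mul_one, segProd]
    rw [← (Equiv.funUnique (Fin 1) G).symm.sum_comp]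
    simp only [Equiv.funUnique_symm_apply, uniqueElim_const, Matrix.one_apply]
    simp
    aesop
  | succ T ih =>
    rw [← (Fin.snocEquiv fun _ : Fin (T + 2) => G).sum_comp, Fintype.sum_prod_type, segProd,
      Matrix.mul_apply, Finset.sum_comm]
    have at_le : ∀ (y : Fin (T + 1) → G) (x : G) (j : ℕ), j ≤ T →
        pathAt j (Fin.snoc (α := fun _ => G) y x : Fin (T + 2) → G) = pathAt j y := by
      intro y x j hj
      simp only [pathAt]
      have : (⟨min j (T + 1), by omega⟩ : Fin (T + 2)) = Fin.castSucc ⟨min j T, by omega⟩ := by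
        ext; simp; omega
      rw [this, Fin.snoc_castSucc]
    have at_last : ∀ (y : Fin (T + 1) → G) (x : G),
        pathAt (T + 1) (Fin.snoc (α := fun _ => G) y x : Fin (T + 2) → G) = x := by
      intro y x
      simp only [pathAt]
      have : (⟨min (T + 1) (T + 1), by omega⟩ : Fin (T + 2)) = Fin.last (T + 1) := by
        ext; simp
      rw [this, Fin.snoc_last]
    have step : ∀ (y : Fin (T + 1) → G) (x : G),
        pathWeight K a b (T + 1) (Fin.snoc (α := fun _ => G) y x : Fin (T + 2) → G) =
        ∑ z, pathWeight K a z T y * (K T z x * if x = b then 1 else 0) := by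
      intro y x
      simp only [pathWeight, at_last, at_le y x 0 (Nat.zero_le _), Finset.prod_range_succ,
        at_le y x T le_rfl]
      rw [Finset.prod_congr rfl fun l hl => by
        rw [at_le y x l (by simp at hl; omega), at_le y x (l + 1) (by simp at hl; omega)]]
      simp only [mul_ite, mul_one, mul_zero, ite_mul, zero_mul, one_mul]
      split_ifs <;> simp
    calc _ = ∑ y : Fin (T + 1) → G, ∑ x, ∑ z,
          pathWeight K a z T y * (K T z x * if x = b then 1 else 0) :=
        Finset.sum_congr rfl fun y _ => Finset.sum_congr rfl fun x _ => step y x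
      _ = ∑ y : Fin (T + 1) → G, ∑ z, pathWeight K a z T y * K T z b := by
        refine Finset.sum_congr rfl fun y _ => ?_
        rw [Finset.sum_comm]
        refine Finset.sum_congr rfl fun z _ => ?_
        simp
      _ = _ := by
        rw [Finset.sum_comm]
        refine Finset.sum_congr rfl fun z _ => ?_
        rw [← Finset.sum_mul, ih, zero_add]

/-- A factor depending on one step and a factor depending on one position are absorbed into the
transition matrices. -/
theorem sum_pathWeight_insert {G : Type*} [Fintype G] [DecidableEq G] (S : Matrix G G ℝ) (a b : G)
    {T i j : ℕ} (hi : i < T) (hj : j < T) (F : G → G → ℝ) (f : G → ℝ) :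
    ∑ y, pathWeight (fun _ => S) a b T y * F (pathAt i y) (pathAt (i + 1) y) * f (pathAt j y) =
      segProd (fun l => (if l = j then Matrix.diagonal f else 1) *
        (if l = i then Matrix.of (fun x x' => S x x' * F x x') else S)) 0 T a b := by
  rw [← sum_pathWeight]
  refine Finset.sum_congr rfl fun y _ => ?_
  have e : ∀ l ∈ Finset.range T, ((if l = j then Matrix.diagonal f else 1) *
        (if l = i then Matrix.of (fun x x' => S x x' * F x x') else S)) (pathAt l y)
          (pathAt (l + 1) y) =
      S (pathAt l y) (pathAt (l + 1) y) * (if l = i then F (pathAt i y) (pathAt (i + 1) y) else 1) *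
        (if l = j then f (pathAt j y) else 1) := by
    intro l _
    by_cases h1 : l = j <;> by_cases h2 : l = i
    · subst h1; subst h2; simp [mul_comm]
    · subst h1; simp [h2, mul_comm]
    · subst h2; simp [h1]
    · simp [h1, h2]
  rw [pathWeight, pathWeight, Finset.prod_congr rfl e, Finset.prod_mul_distrib,
    Finset.prod_mul_distrib, Finset.prod_ite_eq', Finset.prod_ite_eq', if_pos (Finset.mem_range.2 hi),
    if_pos (Finset.mem_range.2 hj)]
  ring

theorem sum_pathWeight_insert_before {G : Type*} [Fintype G] [DecidableEq G] (S : Matrix G G ℝ)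
    (a b : G) {T i j : ℕ} (hi : i < T) (hj : j ≤ i) (F : G → G → ℝ) (f : G → ℝ) :
    ∑ y, pathWeight (fun _ => S) a b T y * F (pathAt i y) (pathAt (i + 1) y) * f (pathAt j y) =
      (S ^ j * Matrix.diagonal f * S ^ (i - j) * Matrix.of (fun x x' => S x x' * F x x') *
        S ^ (T - 1 - i)) a b := by
  rw [sum_pathWeight_insert S a b hi (by omega)]
  obtain ⟨d, rfl⟩ := Nat.exists_eq_add_of_le hj
  obtain ⟨e, rfl⟩ : ∃ e, T = j + (d + (1 + e)) := ⟨T - 1 - (j + d), by omega⟩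
  have h1 : j + d - j = d := by omega
  have h2 : j + (d + (1 + e)) - 1 - (j + d) = e := by omega
  rw [h1, h2, segProd_add, segProd_add, segProd_add, segProd_one]
  rw [segProd_eq_pow (S := S) (s := 0) (l := j), segProd_eq_pow (S := S) (l := e)]
  · rcases d with _ | d
    · simp [segProd, Matrix.mul_assoc]
    · rw [add_comm d 1, segProd_add, segProd_one, segProd_eq_pow (S := S) (l := d)]
      · simp [Matrix.mul_assoc, pow_add]
      · intro l h1 h2
        simp [show l ≠ j by omega, show l ≠ j + (1 + d) by omega]
  · intro l h1 h2
    simp [show l ≠ j by omega, show l ≠ j + d by omega]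
  · intro l h1 h2
    simp [show l ≠ j by omega, show l ≠ j + d by omega]

theorem sum_pathWeight_insert_after {G : Type*} [Fintype G] [DecidableEq G] (S : Matrix G G ℝ)
    (a b : G) {T i j : ℕ} (hi : i < j) (hj : j < T) (F : G → G → ℝ) (f : G → ℝ) :
    ∑ y, pathWeight (fun _ => S) a b T y * F (pathAt i y) (pathAt (i + 1) y) * f (pathAt j y) =
      (S ^ i * Matrix.of (fun x x' => S x x' * F x x') * S ^ (j - i - 1) * Matrix.diagonal f *
        S ^ (T - j)) a b := by
  rw [sum_pathWeight_insert S a b (by omega) hj]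
  obtain ⟨d, rfl⟩ : ∃ d, j = i + (1 + d) := ⟨j - i - 1, by omega⟩
  obtain ⟨e, rfl⟩ : ∃ e, T = i + (1 + (d + (1 + e))) := ⟨T - 1 - (i + (1 + d)), by omega⟩
  have h1 : i + (1 + d) - i - 1 = d := by omega
  have h2 : i + (1 + (d + (1 + e))) - (i + (1 + d)) = 1 + e := by omega
  rw [h1, h2, segProd_add, segProd_add, segProd_add, segProd_add, segProd_one, segProd_one]
  rw [segProd_eq_pow (S := S) (s := 0) (l := i), segProd_eq_pow (S := S) (l := d),
    segProd_eq_pow (S := S) (l := e)]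
  · simp [Matrix.mul_assoc, pow_add, add_assoc]
  all_goals
    intro l h1 h2
    simp [show l ≠ i by omega, show l ≠ i + (1 + d) by omega]

/-! ### Bridges and their extension by a step back and forth -/

section Nonneg

variable {G : Type*} [Fintype G] [DecidableEq G] {S : Matrix G G ℝ}

theorem pow_apply_nonneg (hS : ∀ x y, 0 ≤ S x y) (j : ℕ) (x y : G) : 0 ≤ (S ^ j) x y := by
  induction j generalizing x y with
  | zero => rw [pow_zero, Matrix.one_apply]; split_ifs <;> norm_num
  | succ j ih =>
    rw [pow_succ, Matrix.mul_apply]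
    exact Finset.sum_nonneg fun z _ => mul_nonneg (ih x z) (hS z y)

theorem pow_mul_pow_le (hS : ∀ x y, 0 ≤ S x y) (j l : ℕ) (x y z : G) :
    (S ^ j) x y * (S ^ l) y z ≤ (S ^ (j + l)) x z := by
  rw [pow_add, Matrix.mul_apply]
  exact Finset.single_le_sum (f := fun y => (S ^ j) x y * (S ^ l) y z)
    (fun y _ => mul_nonneg (pow_apply_nonneg hS j x y) (pow_apply_nonneg hS l y z))
    (Finset.mem_univ y)

theorem sum_pow_mul_pow (j l : ℕ) (x z : G) :
    ∑ y, (S ^ j) x y * (S ^ l) y z = (S ^ (j + l)) x z := by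
  rw [pow_add, Matrix.mul_apply]

/-- The law at time `j` of the walk with transition weights `S` from `a`, conditioned to be at `b`
at time `t`. -/
noncomputable def bridgeLaw (S : Matrix G G ℝ) (a b : G) (t j : ℕ) (z : G) : ℝ :=
  (S ^ j) a z * (S ^ (t - j)) z b / (S ^ t) a b

/-- Take a bridge `X` from `a` to `b` of length `t`, follow it up to time `i + 1`, step back to a
point drawn from the law of `X i` given `X (i + 1)`, and go on from there as the bridge does after
time `i`. The law of the resulting path of length `t + 2` has, relative to `pathWeight`, the density
`insertDensity S a b t i x x'`, where `x` and `x'` are its positions at times `i + 1`, `i + 2`. -/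
noncomputable def insertDensity (S : Matrix G G ℝ) (a b : G) (t i : ℕ) (x x' : G) : ℝ :=
  (S ^ (t - 1 - i)) x b * (S ^ i) a x' /
    ((S ^ t) a b * ((S ^ (i + 1)) a x * (S ^ (t - i)) x' b))

theorem insertDensity_nonneg (hS : ∀ x y, 0 ≤ S x y) (a b : G) (t i : ℕ) (x x' : G) :
    0 ≤ insertDensity S a b t i x x' := by
  have := pow_apply_nonneg hS
  exact div_nonneg (mul_nonneg (this _ _ _) (this _ _ _))
    (mul_nonneg (this _ _ _) (mul_nonneg (this _ _ _) (this _ _ _)))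

/-- Detailed balance: the step inserted at time `i + 1` is a step of the bridge run backwards. -/
theorem insertDensity_balance (hS : ∀ x y, 0 ≤ S x y) (hsymm : ∀ x y, S x y = S y x) (a b : G)
    {t i : ℕ} (hi : i < t) (x x' : G) :
    (S ^ (i + 1)) a x * (S x x' * insertDensity S a b t i x x') * (S ^ (t - i)) x' b =
      (S ^ i) a x' * S x' x * (S ^ (t - 1 - i)) x b / (S ^ t) a b := by
  have h1 : (S ^ i) a x' * S x' x ≤ (S ^ (i + 1)) a x := by
    simpa using pow_mul_pow_le hS i 1 a x' x
  have h2 : S x' x * (S ^ (t - 1 - i)) x b ≤ (S ^ (t - i)) x' b := by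
    have := pow_mul_pow_le hS 1 (t - 1 - i) x' x b
    rwa [pow_one, show 1 + (t - 1 - i) = t - i by omega] at this
  have n1 := pow_apply_nonneg hS i a x'
  have n2 := pow_apply_nonneg hS (t - 1 - i) x b
  have n3 := hS x' x
  rw [insertDensity, hsymm x x']
  rcases eq_or_ne ((S ^ (i + 1)) a x) 0 with h | h
  · rw [h] at h1 ⊢
    have : (S ^ i) a x' * S x' x = 0 := le_antisymm h1 (by positivity)
    rw [this]; simp
  rcases eq_or_ne ((S ^ (t - i)) x' b) 0 with h' | h'
  · rw [h'] at h2 ⊢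
    have : S x' x * (S ^ (t - 1 - i)) x b = 0 := le_antisymm h2 (by positivity)
    rw [mul_assoc ((S ^ i) a x'), this]; simp
  rcases eq_or_ne ((S ^ t) a b) 0 with h'' | h''
  · simp [h'']
  field_simp

/-- Given the position `x` at time `i + 1`, the extended bridge goes on with the same weight as the
bridge. -/
theorem sum_insertDensity_left (hS : ∀ x y, 0 ≤ S x y) (hsymm : ∀ x y, S x y = S y x) (a b : G)
    {t i : ℕ} (hi : i < t) {x : G} (hx : (S ^ (i + 1)) a x ≠ 0) :
    ∑ x', S x x' * insertDensity S a b t i x x' * (S ^ (t - i)) x' b =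
      (S ^ (t - 1 - i)) x b / (S ^ t) a b := by
  refine mul_left_cancel₀ hx ?_
  rw [Finset.mul_sum]
  simp only [← mul_assoc _ (S _ _ * _)]
  simp only [insertDensity_balance hS hsymm a b hi]
  rw [← Finset.sum_div, ← Finset.sum_mul]
  have := sum_pow_mul_pow (S := S) i 1 a x
  rw [pow_one] at this
  rw [this, mul_div_assoc]

theorem sum_insertDensity_right (hS : ∀ x y, 0 ≤ S x y) (hsymm : ∀ x y, S x y = S y x) (a b : G)
    {t i : ℕ} (hi : i < t) {x' : G} (hx : (S ^ (t - i)) x' b ≠ 0) :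
    ∑ x, (S ^ (i + 1)) a x * (S x x' * insertDensity S a b t i x x') =
      (S ^ i) a x' / (S ^ t) a b := by
  refine mul_right_cancel₀ hx ?_
  rw [Finset.sum_mul]
  simp only [insertDensity_balance hS hsymm a b hi]
  have := sum_pow_mul_pow (S := S) 1 (t - 1 - i) x' b
  rw [pow_one, show 1 + (t - 1 - i) = t - i by omega] at this
  rw [← Finset.sum_div]
  simp only [mul_assoc]
  rw [← Finset.mul_sum, this]
  ring

/-- Up to the time of the insertion the extended bridge is the bridge. -/
theorem insert_marginal_before (hS : ∀ x y, 0 ≤ S x y) (hsymm : ∀ x y, S x y = S y x) (a b : G)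
    {t i j : ℕ} (hi : i < t) (hj : j ≤ i + 1) (z : G) :
    ∑ y, pathWeight (fun _ => S) a b (t + 2) y *
        insertDensity S a b t i (pathAt (i + 1) y) (pathAt (i + 2) y) *
        (if pathAt j y = z then 1 else 0) = bridgeLaw S a b t j z := by
  have h := sum_pathWeight_insert_before S a b (T := t + 2) (i := i + 1) (by omega) hj
    (insertDensity S a b t i) (fun x => if x = z then 1 else 0)
  rw [h, Matrix.mul_assoc, Matrix.mul_apply]
  have e1 : ∀ x, (S ^ j * Matrix.diagonal (fun x => if x = z then (1 : ℝ) else 0) *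
      S ^ (i + 1 - j)) a x = (S ^ j) a z * (S ^ (i + 1 - j)) z x := by
    intro x
    rw [Matrix.mul_apply]
    simp [Matrix.mul_diagonal]
  have e2 : ∀ x, (S ^ j) a z * (S ^ (i + 1 - j)) z x *
      (Matrix.of (fun x x' => S x x' * insertDensity S a b t i x x') *
        S ^ (t + 2 - 1 - (i + 1))) x b =
      (S ^ j) a z * (S ^ (i + 1 - j)) z x * ((S ^ (t - 1 - i)) x b / (S ^ t) a b) := by
    intro x
    rcases eq_or_ne ((S ^ (i + 1)) a x) 0 with h | h
    · have := pow_mul_pow_le hS j (i + 1 - j) a z x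
      rw [show j + (i + 1 - j) = i + 1 by omega, h] at this
      have h0 : (S ^ j) a z * (S ^ (i + 1 - j)) z x = 0 :=
        le_antisymm this (mul_nonneg (pow_apply_nonneg hS _ _ _) (pow_apply_nonneg hS _ _ _))
      rw [h0]; simp
    · rw [← sum_insertDensity_left hS hsymm a b hi h, Matrix.mul_apply,
        show t + 2 - 1 - (i + 1) = t - i by omega]
      rfl
  simp only [e1, e2]
  have := sum_pow_mul_pow (S := S) (i + 1 - j) (t - 1 - i) z b
  rw [show i + 1 - j + (t - 1 - i) = t - j by omega] at this
  rw [bridgeLaw, mul_div_assoc, ← this, Finset.sum_div, Finset.mul_sum]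
  exact Finset.sum_congr rfl fun x _ => by ring

/-- After the insertion the extended bridge is the bridge delayed by two steps. -/
theorem insert_marginal_after (hS : ∀ x y, 0 ≤ S x y) (hsymm : ∀ x y, S x y = S y x) (a b : G)
    {t i j : ℕ} (hi : i < t) (hj : i + 2 ≤ j) (hjt : j ≤ t) (z : G) :
    ∑ y, pathWeight (fun _ => S) a b (t + 2) y *
        insertDensity S a b t i (pathAt (i + 1) y) (pathAt (i + 2) y) *
        (if pathAt j y = z then 1 else 0) = bridgeLaw S a b t (j - 2) z := by
  have h := sum_pathWeight_insert_after S a b (T := t + 2) (i := i + 1) (j := j) (by omega)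
    (by omega) (insertDensity S a b t i) (fun x => if x = z then 1 else 0)
  rw [h]
  have e1 : ∀ M : Matrix G G ℝ, (M * Matrix.diagonal (fun x => if x = z then (1 : ℝ) else 0) *
      S ^ (t + 2 - j)) a b = M a z * (S ^ (t + 2 - j)) z b := by
    intro M
    rw [Matrix.mul_apply]
    simp [Matrix.mul_diagonal]
  rw [e1, Matrix.mul_apply, Finset.sum_mul]
  have e2 : ∀ x', (S ^ (i + 1) * Matrix.of (fun x x' => S x x' * insertDensity S a b t i x x')) a x' *
      (S ^ (j - (i + 1) - 1)) x' z * (S ^ (t + 2 - j)) z b =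
      (S ^ i) a x' / (S ^ t) a b * ((S ^ (j - (i + 1) - 1)) x' z * (S ^ (t + 2 - j)) z b) := by
    intro x'
    rw [mul_assoc]
    rcases eq_or_ne ((S ^ (t - i)) x' b) 0 with h | h
    · have := pow_mul_pow_le hS (j - (i + 1) - 1) (t + 2 - j) x' z b
      rw [show j - (i + 1) - 1 + (t + 2 - j) = t - i by omega, h] at this
      have h0 : (S ^ (j - (i + 1) - 1)) x' z * (S ^ (t + 2 - j)) z b = 0 :=
        le_antisymm this (mul_nonneg (pow_apply_nonneg hS _ _ _) (pow_apply_nonneg hS _ _ _))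
      rw [h0]; simp
    · rw [← sum_insertDensity_right hS hsymm a b hi h, Matrix.mul_apply]
      rfl
  simp only [e2]
  have := sum_pow_mul_pow (S := S) i (j - (i + 1) - 1) a z
  rw [show i + (j - (i + 1) - 1) = j - 2 by omega] at this
  rw [bridgeLaw, ← this, Finset.sum_mul, Finset.sum_div]
  refine Finset.sum_congr rfl fun x _ => ?_
  rw [show t - (j - 2) = t + 2 - j by omega]
  ring

theorem sum_bridgeLaw {a b : G} {t j : ℕ} (hm : (S ^ t) a b ≠ 0) (hj : j ≤ t) :
    ∑ z, bridgeLaw S a b t j z = 1 := by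
  simp only [bridgeLaw]
  rw [← Finset.sum_div, sum_pow_mul_pow, Nat.add_sub_cancel' hj, div_self hm]

/-- The mean, over the position `z` of the bridge at time `j`, of the logarithm of the ratio of the
weight `(S ^ j) a z` behind the bridge to the weight `(S ^ (t - j)) z b` ahead of it. -/
noncomputable def bridgePotential (S : Matrix G G ℝ) (a b : G) (t j : ℕ) : ℝ :=
  ∑ z, bridgeLaw S a b t j z * (Real.log ((S ^ j) a z) - Real.log ((S ^ (t - j)) z b))

/-- The relative entropies of the extended bridges telescope when summed over the time of the insertion. -/
theorem relEntropy_insertDensity (hS : ∀ x y, 0 ≤ S x y) (hsymm : ∀ x y, S x y = S y x) {a b : G}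
    {t i : ℕ} (hm : (S ^ t) a b ≠ 0) (hi : i < t) :
    relEntropy (pathWeight (fun _ => S) a b (t + 2))
        (fun y => insertDensity S a b t i (pathAt (i + 1) y) (pathAt (i + 2) y)) =
      - Real.log ((S ^ t) a b) + bridgePotential S a b t i - bridgePotential S a b t (i + 1) := by
  have h := sum_pathWeight_insert_before S a b (T := t + 2) (i := i + 1) (j := 0) (by omega)
    (Nat.zero_le _)
    (fun x x' => insertDensity S a b t i x x' * Real.log (insertDensity S a b t i x x'))
    (fun _ => 1)
  simp only [mul_one, Matrix.diagonal_one, pow_zero, Nat.sub_zero, one_mul] at h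
  rw [relEntropy, h, Matrix.mul_apply, show t + 2 - 1 - (i + 1) = t - i by omega]
  -- the joint law of the positions at times `i` and `i + 1`
  set J : G → G → ℝ := fun x x' => (S ^ i) a x' * S x' x * (S ^ (t - 1 - i)) x b / (S ^ t) a b
    with hJ
  have e1 : ∀ x', (S ^ (i + 1) * Matrix.of (fun x x' => S x x' * (insertDensity S a b t i x x' *
        Real.log (insertDensity S a b t i x x')))) a x' * (S ^ (t - i)) x' b =
      ∑ x, J x x' * (- Real.log ((S ^ t) a b)
        + (Real.log ((S ^ i) a x') - Real.log ((S ^ (t - i)) x' b))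
        - (Real.log ((S ^ (i + 1)) a x) - Real.log ((S ^ (t - (i + 1))) x b))) := by
    intro x'
    rw [Matrix.mul_apply, Finset.sum_mul]
    refine Finset.sum_congr rfl fun x _ => ?_
    have hb := insertDensity_balance hS hsymm a b hi x x'
    rw [Matrix.of_apply]
    calc _ = ((S ^ (i + 1)) a x * (S x x' * insertDensity S a b t i x x') * (S ^ (t - i)) x' b) *
          Real.log (insertDensity S a b t i x x') := by ring
      _ = J x x' * Real.log (insertDensity S a b t i x x') := by rw [hb]
      _ = _ := by
        rcases eq_or_ne (J x x') 0 with h0 | h0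
        · rw [h0]; simp
        · have hb' := h0
          rw [hJ] at hb'
          simp only at hb'
          rw [← hb] at hb'
          have h1 : (S ^ (i + 1)) a x ≠ 0 := fun h => hb' (by simp [h])
          have h2 : (S ^ (t - i)) x' b ≠ 0 := fun h => hb' (by simp [h])
          have h3 : (S ^ i) a x' ≠ 0 := fun h => h0 (by simp [hJ, h])
          have h4 : (S ^ (t - 1 - i)) x b ≠ 0 := fun h => h0 (by simp [hJ, h])
          rw [insertDensity, Real.log_div (mul_ne_zero h4 h3)
            (mul_ne_zero hm (mul_ne_zero h1 h2)), Real.log_mul h4 h3,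
            Real.log_mul hm (mul_ne_zero h1 h2), Real.log_mul h1 h2,
            show t - (i + 1) = t - 1 - i by omega]
          ring
  have m1 : ∀ x', ∑ x, J x x' = bridgeLaw S a b t i x' := by
    intro x'
    have := sum_pow_mul_pow (S := S) 1 (t - 1 - i) x' b
    rw [pow_one, show 1 + (t - 1 - i) = t - i by omega] at this
    rw [bridgeLaw, hJ, ← Finset.sum_div]
    simp only [mul_assoc]
    rw [← Finset.mul_sum, this]
  have m2 : ∀ x, ∑ x', J x x' = bridgeLaw S a b t (i + 1) x := by
    intro x
    have := sum_pow_mul_pow (S := S) i 1 a x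
    rw [pow_one] at this
    rw [bridgeLaw, hJ, ← Finset.sum_div, ← Finset.sum_mul, this,
      show t - (i + 1) = t - 1 - i by omega]
  simp only [e1, mul_sub, mul_add, Finset.sum_sub_distrib, Finset.sum_add_distrib]
  rw [Finset.sum_comm (f := fun x' x => J x x' * Real.log ((S ^ (i + 1)) a x)),
    Finset.sum_comm (f := fun x' x => J x x' * Real.log ((S ^ (t - (i + 1))) x b))]
  simp only [← Finset.sum_mul, m1, m2, sum_bridgeLaw hm hi.le]
  simp only [bridgePotential, mul_sub, Finset.sum_sub_distrib]
  ring

theorem bridgePotential_zero (a b : G) {t : ℕ} (hm : (S ^ t) a b ≠ 0) :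
    bridgePotential S a b t 0 = - Real.log ((S ^ t) a b) := by
  rw [bridgePotential, Finset.sum_eq_single a]
  · simp [bridgeLaw, div_self hm]
  · intro z _ hz
    simp [bridgeLaw, Matrix.one_apply_ne hz.symm]
  · simp

theorem bridgePotential_last (a b : G) {t : ℕ} (hm : (S ^ t) a b ≠ 0) :
    bridgePotential S a b t t = Real.log ((S ^ t) a b) := by
  rw [bridgePotential, Finset.sum_eq_single b]
  · simp [bridgeLaw, div_self hm]
  · intro z _ hz
    simp [bridgeLaw, Matrix.one_apply_ne hz]
  · simp

/-- If the positions of a bridge at the times `j - 1` and `j + 1` overlap, exchanging the parts of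
two bridges yields a bridge that is two steps longer and one that is two steps shorter. -/
theorem sq_le_of_overlap (hS : ∀ x y, 0 ≤ S x y) {a b : G} {t j : ℕ} (hm : 0 < (S ^ t) a b)
    (hj : 1 ≤ j) (hjt : j < t) {η : ℝ} (hη : 0 ≤ η)
    (h : η ≤ ∑ z, √(bridgeLaw S a b t (j - 1) z * bridgeLaw S a b t (j + 1) z)) :
    (η * (S ^ t) a b) ^ 2 ≤ (S ^ (t + 2)) a b * (S ^ (t - 2)) a b := by
  have hp := pow_apply_nonneg hS
  have e : ∀ z, √(bridgeLaw S a b t (j - 1) z * bridgeLaw S a b t (j + 1) z) * (S ^ t) a b =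
      √((S ^ (j - 1)) a z * (S ^ (t - (j + 1))) z b) *
      √((S ^ (j + 1)) a z * (S ^ (t - (j - 1))) z b) := by
    intro z
    rw [← Real.sqrt_mul (mul_nonneg (hp _ _ _) (hp _ _ _)), show ∀ r, √r * (S ^ t) a b = √(r * (S ^ t) a b ^ 2) from
        fun r => by rw [Real.sqrt_mul' _ (by positivity), Real.sqrt_sq hm.le]]
    congr 1
    simp only [bridgeLaw]
    field_simp
  have h1 := mul_le_mul_of_nonneg_right h hm.le
  rw [Finset.sum_mul] at h1
  simp only [e] at h1
  have h2 := h1.trans (Real.sum_sqrt_mul_sqrt_le Finset.univ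
    (fun z => mul_nonneg (hp _ _ _) (hp _ _ _)) (fun z => mul_nonneg (hp _ _ _) (hp _ _ _)))
  rw [sum_pow_mul_pow, sum_pow_mul_pow, show j - 1 + (t - (j + 1)) = t - 2 by omega,
    show j + 1 + (t - (j - 1)) = t + 2 by omega, ← Real.sqrt_mul (hp _ _ _)] at h2
  have := pow_le_pow_left₀ (by positivity) h2 2
  rwa [Real.sq_sqrt (mul_nonneg (hp _ _ _) (hp _ _ _)), mul_comm ((S ^ (t - 2)) a b)] at this

/-- **Near log-convexity of measured heat.** For a symmetric nonnegative matrix, the entry at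
`(a, b)` of the power `t + 2` exceeds the power mean bound `m ^ (1 + 2 / t)` by the factor `√t`,
unless the entries of the powers `t - 2`, `t`, `t + 2` are log-convex up to a constant. The condition
`2 ≤ t` says that `t - 2` is not truncated. -/
theorem heat_near_log_convex (hS : ∀ x y, 0 ≤ S x y) (hsymm : ∀ x y, S x y = S y x) (a b : G)
    {t s : ℕ} (ht : t = 2 ^ s) :
    √t * (S ^ t) a b ^ (1 + 2 / (t : ℝ)) ≤ (S ^ (t + 2)) a b ∨
      2 ≤ t ∧ ((S ^ t) a b) ^ 2 ≤ 9 * ((S ^ (t + 2)) a b * (S ^ (t - 2)) a b) := by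
  have ht0 : 0 < t := by rw [ht]; positivity
  have htR : (0 : ℝ) < t := by exact_mod_cast ht0
  have hp := pow_apply_nonneg hS
  rcases (hp t a b).eq_or_lt with hm | hm
  · left
    rw [← hm, Real.zero_rpow (by positivity), mul_zero]
    exact hp _ _ _
  by_cases hov : ∃ j, 1 ≤ j ∧ j < t ∧
      1 / 3 ≤ ∑ z, √(bridgeLaw S a b t (j - 1) z * bridgeLaw S a b t (j + 1) z)
  · obtain ⟨j, h1, h2, h3⟩ := hov
    right
    refine ⟨by omega, ?_⟩
    have := sq_le_of_overlap hS hm h1 h2 (by norm_num) h3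
    nlinarith
  left
  push Not at hov
  have hw : ∀ y, 0 ≤ pathWeight (fun _ => S) a b (t + 2) y := by
    intro y
    refine mul_nonneg (mul_nonneg ?_ (Finset.prod_nonneg fun _ _ => hS _ _)) ?_ <;>
    split_ifs <;> norm_num
  set q : ℕ → (Fin (t + 2 + 1) → G) → ℝ :=
    fun i y => insertDensity S a b t i (pathAt (i + 1) y) (pathAt (i + 2) y) with hq
  have hq1 : ∀ i < t, ∑ y, pathWeight (fun _ => S) a b (t + 2) y * q i y = 1 := by
    intro i hi
    rw [← sum_bridgeLaw hm.ne' (Nat.zero_le t)]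
    simp only [← insert_marginal_before hS hsymm a b hi (Nat.zero_le _)]
    rw [Finset.sum_comm]
    refine Finset.sum_congr rfl fun y _ => ?_
    simp [hq]
  obtain ⟨b0, b1, -, -, b4⟩ := dyadicMean_bounds (N := t) hw
    (fun i _ y => insertDensity_nonneg hS a b t i _ _ : ∀ i < t, ∀ y, 0 ≤ q i y) hq1
    (fun j y => pathAt j y) (bridgeLaw S a b t)
    (fun i hi j hj z => insert_marginal_before hS hsymm a b hi hj z)
    (fun i hi j hj hjt z => insert_marginal_after hS hsymm a b hi hj hjt z)
    (fun j h1 h2 => (hov j h1 h2).le) s 0 (by omega)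
  obtain ⟨hM, hent⟩ := neg_log_sum_le_relEntropy hw b0 b1
  rw [sum_pathWeight, segProd_eq_pow (S := S) fun _ _ _ => rfl] at hM hent
  have hD : ∑ i ∈ Finset.range (2 ^ s),
      relEntropy (pathWeight (fun _ => S) a b (t + 2)) (q (0 + i)) =
      - (t + 2) * Real.log ((S ^ t) a b) := by
    rw [← ht]
    calc _ = ∑ i ∈ Finset.range t, (- Real.log ((S ^ t) a b) +
          (bridgePotential S a b t i - bridgePotential S a b t (i + 1))) := by
          refine Finset.sum_congr rfl fun i hi => ?_
          rw [zero_add, relEntropy_insertDensity hS hsymm hm.ne' (by simpa using hi)]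
          ring
      _ = _ := by
        rw [Finset.sum_add_distrib, Finset.sum_range_sub', bridgePotential_zero a b hm.ne',
          bridgePotential_last a b hm.ne']
        simp
        ring
  rw [hD] at b4
  have hts : (2 : ℝ) ^ s = t := by rw [ht]; push_cast; rfl
  have hlt : Real.log t = s * Real.log 2 := by rw [← hts, Real.log_pow]
  have hl2 := Real.log_two_gt_d9
  rw [← Real.log_le_log_iff (by positivity) hM, Real.log_mul (by positivity) (by positivity),
    Real.log_sqrt htR.le, Real.log_rpow hm, hlt]
  rw [hts] at b4
  have e : -((t : ℝ) + 2) * Real.log ((S ^ t) a b) / t =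
      -((1 + 2 / t) * Real.log ((S ^ t) a b)) := by field_simp
  rw [e] at b4
  have hs0 : (0 : ℝ) ≤ s := Nat.cast_nonneg s
  nlinarith

end Nonneg

/-! ### The random walk on a group and its images -/

/-- Transition matrix of the walk on `G` that adds a uniformly chosen one of `h 0, …, h (n - 1)`. -/
noncomputable def stepMatrix {G : Type*} [AddCommGroup G] [DecidableEq G] {n : ℕ} (h : Fin n → G) :
    Matrix G G ℝ :=
  Matrix.of fun x y => (∑ i, if x + h i = y then 1 else 0) / n

theorem stepMatrix_nonneg {G : Type*} [AddCommGroup G] [DecidableEq G] {n : ℕ} (h : Fin n → G)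
    (x y : G) : 0 ≤ stepMatrix h x y := by
  refine div_nonneg (Finset.sum_nonneg fun i _ => ?_) (Nat.cast_nonneg n)
  split_ifs <;> norm_num

theorem stepMatrix_symm {G : Type*} [AddCommGroup G] [DecidableEq G] {n : ℕ} {h : Fin n → G}
    (hh : ∀ i, h i + h i = 0) (x y : G) : stepMatrix h x y = stepMatrix h y x := by
  simp only [stepMatrix, Matrix.of_apply]
  congr 1
  refine Finset.sum_congr rfl fun i _ => ?_
  have : x + h i = y ↔ y + h i = x := by
    constructor <;> rintro rfl <;> rw [add_assoc, hh, add_zero]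
  simp [this]

theorem stepMatrix_mulVec {G : Type*} [AddCommGroup G] [Fintype G] [DecidableEq G] {n : ℕ}
    (h : Fin n → G) (g : G → ℝ) (x : G) :
    (stepMatrix h).mulVec g x = (∑ i, g (x + h i)) / n := by
  simp only [Matrix.mulVec, dotProduct, stepMatrix, Matrix.of_apply, div_mul_eq_mul_div,
    Finset.sum_mul]
  rw [← Finset.sum_div, Finset.sum_comm]
  simp

theorem stepMatrix_pow_succ_mulVec {G : Type*} [AddCommGroup G] [Fintype G] [DecidableEq G] {n : ℕ}
    (h : Fin n → G) (g : G → ℝ) (t : ℕ) (x : G) :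
    (stepMatrix h ^ (t + 1)).mulVec g x = (∑ i, (stepMatrix h ^ t).mulVec g (x + h i)) / n := by
  rw [pow_succ', ← Matrix.mulVec_mulVec, stepMatrix_mulVec]

/-- Homomorphic images of the walk are walks. -/
theorem stepMatrix_pow_mulVec_comp {E G : Type*} [AddCommGroup E] [Fintype E] [DecidableEq E]
    [AddCommGroup G] [Fintype G] [DecidableEq G] {n : ℕ} (e : Fin n → E) (φ : E →+ G) (g : G → ℝ)
    (t : ℕ) (x : E) :
    (stepMatrix e ^ t).mulVec (g ∘ φ) x = (stepMatrix (φ ∘ e) ^ t).mulVec g (φ x) := by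
  induction t generalizing x with
  | zero => simp
  | succ t ih => simp [stepMatrix_pow_succ_mulVec, ih]

theorem mulVec_mono {G : Type*} [Fintype G] {S : Matrix G G ℝ} (hS : ∀ x y, 0 ≤ S x y)
    {f g : G → ℝ} (h : ∀ x, f x ≤ g x) (x : G) : S.mulVec f x ≤ S.mulVec g x :=
  Finset.sum_le_sum fun y _ => mul_le_mul_of_nonneg_left (h y) (hS x y)

theorem stepMatrix_pow_mulVec_one {G : Type*} [AddCommGroup G] [Fintype G] [DecidableEq G] {n : ℕ}
    (hn : n ≠ 0) (h : Fin n → G) (t : ℕ) : (stepMatrix h ^ t).mulVec 1 = 1 := by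
  induction t with
  | zero => simp
  | succ t ih =>
    ext x
    simp [stepMatrix_pow_succ_mulVec, ih, hn]

/-! ### Nonnegative combinations of affine subspaces -/

/-- `A` is the solution set of a system of linear equations, that is, a fiber of an additive map to
a finite group. The empty set is allowed. -/
def IsFiber {n : ℕ} (A : Set (Fin n → ZMod 2)) : Prop :=
  ∃ (G : Type) (_ : AddCommGroup G) (_ : Fintype G) (_ : DecidableEq G)
    (φ : (Fin n → ZMod 2) →+ G) (b : G), A = {x | φ x = b}

theorem isFiber_univ {n : ℕ} : IsFiber (Set.univ : Set (Fin n → ZMod 2)) :=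
  ⟨ZMod 2, inferInstance, inferInstance, inferInstance, 0, 0, by simp⟩

theorem IsFiber.inter {n : ℕ} {A B : Set (Fin n → ZMod 2)} (hA : IsFiber A) (hB : IsFiber B) :
    IsFiber (A ∩ B) := by
  obtain ⟨G, _, _, _, φ, b, rfl⟩ := hA
  obtain ⟨H, _, _, _, ψ, c, rfl⟩ := hB
  refine ⟨G × H, inferInstance, inferInstance, inferInstance, φ.prod ψ, (b, c), ?_⟩
  ext x
  simp [Prod.ext_iff]

theorem isFiber_dotProduct {n : ℕ} (y : Fin n → ZMod 2) (b : ZMod 2) :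
    IsFiber {x : Fin n → ZMod 2 | dotProduct x y = b} :=
  ⟨ZMod 2, inferInstance, inferInstance, inferInstance,
    { toFun := fun x => dotProduct x y
      map_zero' := by simp
      map_add' := fun x x' => by simp [add_dotProduct] }, b, rfl⟩

/-- The simple random walk on the hypercube. -/
noncomputable def cubeWalk (n : ℕ) : Matrix (Fin n → ZMod 2) (Fin n → ZMod 2) ℝ :=
  stepMatrix fun i => Pi.single i 1

/-- Near log-convexity of the probability `m j` that the walk from `x` is in `A` after `j` steps: its
image in the quotient by the direction of `A` is a symmetric walk that hits one point. -/
theorem IsFiber.near_log_convex {n : ℕ} {A : Set (Fin n → ZMod 2)} (hA : IsFiber A)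
    (x : Fin n → ZMod 2) {t s : ℕ} (ht : t = 2 ^ s) (m : ℕ → ℝ)
    (hm : m = fun j => (cubeWalk n ^ j).mulVec (A.indicator 1) x) :
    √t * m t ^ (1 + 2 / (t : ℝ)) ≤ m (t + 2) ∨ m t ^ 2 ≤ 9 * (m (t + 2) * m (t - 2)) := by
  obtain ⟨G, _, _, _, φ, b, rfl⟩ := hA
  have e : ({x | φ x = b} : Set (Fin n → ZMod 2)).indicator (1 : (Fin n → ZMod 2) → ℝ) =
      (fun z => if z = b then 1 else 0) ∘ φ := by
    ext x
    simp [Set.indicator_apply]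
  have h : ∀ j, m j = (stepMatrix (φ ∘ fun i => Pi.single i 1) ^ j) (φ x) b := by
    intro j
    rw [hm]
    simp only
    rw [e, cubeWalk, stepMatrix_pow_mulVec_comp]
    simp [Matrix.mulVec, dotProduct]
  simp only [h]
  refine (heat_near_log_convex (stepMatrix_nonneg _) (stepMatrix_symm fun i => ?_) (φ x) b ht).imp
    id fun h => h.2
  simp only [Function.comp]
  rw [← map_add, ← Pi.single_add]
  have : (1 : ZMod 2) + 1 = 0 := by decide
  simp [this]

/-- `f` is a combination of indicators of affine subspaces with nonnegative coefficients of
sum `W`. -/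
def HasAffineWeight {n : ℕ} (f : (Fin n → ZMod 2) → ℝ) (W : ℝ) : Prop :=
  ∃ (ι : Type) (_ : Fintype ι) (w : ι → ℝ) (A : ι → Set (Fin n → ZMod 2)),
    (∀ i, 0 ≤ w i) ∧ (∀ i, IsFiber (A i)) ∧ ∑ i, w i = W ∧
      ∀ x, f x = ∑ i, w i * (A i).indicator 1 x

theorem HasAffineWeight.mul {n : ℕ} {f g : (Fin n → ZMod 2) → ℝ} {V W : ℝ}
    (hf : HasAffineWeight f V) (hg : HasAffineWeight g W) : HasAffineWeight (f * g) (V * W) := by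
  obtain ⟨ι, _, v, A, v0, hA, rfl, hf⟩ := hf
  obtain ⟨κ, _, w, B, w0, hB, rfl, hg⟩ := hg
  refine ⟨ι × κ, inferInstance, fun p => v p.1 * w p.2, fun p => A p.1 ∩ B p.2,
    fun p => mul_nonneg (v0 _) (w0 _), fun p => (hA _).inter (hB _), ?_, fun x => ?_⟩
  · rw [Fintype.sum_mul_sum, Fintype.sum_prod_type]
  · rw [Pi.mul_apply, hf, hg, Fintype.sum_mul_sum, Fintype.sum_prod_type]
    refine Finset.sum_congr rfl fun i _ => Finset.sum_congr rfl fun j _ => ?_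
    rw [Set.inter_indicator_one, Pi.mul_apply]
    ring

theorem HasAffineWeight.pow {n : ℕ} {f : (Fin n → ZMod 2) → ℝ} {W : ℝ}
    (hf : HasAffineWeight f W) (r : ℕ) : HasAffineWeight (f ^ r) (W ^ r) := by
  induction r with
  | zero =>
    exact ⟨Unit, inferInstance, fun _ => 1, fun _ => Set.univ, by simp, fun _ => isFiber_univ,
      by simp, by simp⟩
  | succ r ih => rw [pow_succ, pow_succ]; exact ih.mul hf

/-- The near log-convexity of each affine subspace carries over to combinations whose total weight
`W` is small. -/
theorem HasAffineWeight.le_of_overlap_le {n : ℕ} {f : (Fin n → ZMod 2) → ℝ} {W : ℝ}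
    (hf : HasAffineWeight f W) (x : Fin n → ZMod 2) {t s : ℕ} (ht : t = 2 ^ s) {M : ℕ → ℝ}
    (hM : M = fun j => (cubeWalk n ^ j).mulVec f x) (h : 6 * √(M (t + 2) * M (t - 2)) ≤ M t) :
    √t * (M t / 2) ^ (1 + 2 / (t : ℝ)) ≤ W ^ (2 / (t : ℝ)) * M (t + 2) := by
  classical
  obtain ⟨ι, _, w, A, w0, hA, rfl, hf⟩ := hf
  have ht0 : 0 < t := by rw [ht]; positivity
  have htR : (0 : ℝ) < t := by exact_mod_cast ht0
  set m : ι → ℕ → ℝ := fun i j => (cubeWalk n ^ j).mulVec ((A i).indicator 1) x with hm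
  have m0 : ∀ i j, 0 ≤ m i j := fun i j => Finset.sum_nonneg fun y _ =>
    mul_nonneg (pow_apply_nonneg (stepMatrix_nonneg _) _ _ _)
      (Set.indicator_nonneg (fun _ _ => zero_le_one) _)
  have hMm : ∀ j, M j = ∑ i, w i * m i j := by
    intro j
    rw [hM]
    simp only [hm, Matrix.mulVec, dotProduct, Finset.mul_sum, hf]
    rw [Finset.sum_comm]
    exact Finset.sum_congr rfl fun i _ => Finset.sum_congr rfl fun y _ => by ring
  have M0 : ∀ j, 0 ≤ M j := fun j => by
    rw [hMm]; exact Finset.sum_nonneg fun i _ => mul_nonneg (w0 i) (m0 i j)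
  -- the subspaces for which the first alternative of the near log-convexity holds
  set good : Finset ι := Finset.univ.filter fun i =>
    √t * m i t ^ (1 + 2 / (t : ℝ)) ≤ m i (t + 2) with hgood
  have hbad : ∑ i with ¬ (√t * m i t ^ (1 + 2 / (t : ℝ)) ≤ m i (t + 2)), w i * m i t ≤
      3 * √(M (t + 2) * M (t - 2)) := by
    calc _ ≤ ∑ i with ¬ (√t * m i t ^ (1 + 2 / (t : ℝ)) ≤ m i (t + 2)),
          3 * (√(w i * m i (t + 2)) * √(w i * m i (t - 2))) := by
          refine Finset.sum_le_sum fun i hi => ?_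
          have h2 := ((hA i).near_log_convex x ht (m i) rfl).resolve_left (Finset.mem_filter.1 hi).2
          rw [← Real.sqrt_mul (mul_nonneg (w0 i) (m0 _ _)),
            show w i * m i (t + 2) * (w i * m i (t - 2)) = w i ^ 2 * (m i (t + 2) * m i (t - 2)) by
              ring, Real.sqrt_mul (sq_nonneg _), Real.sqrt_sq (w0 i), mul_left_comm]
          refine mul_le_mul_of_nonneg_left ?_ (w0 i)
          refine abs_le_of_sq_le_sq' ?_ (by positivity) |>.2
          rw [mul_pow, Real.sq_sqrt (mul_nonneg (m0 _ _) (m0 _ _))]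
          linarith
      _ ≤ ∑ i, 3 * (√(w i * m i (t + 2)) * √(w i * m i (t - 2))) :=
          Finset.sum_le_sum_of_subset_of_nonneg (Finset.subset_univ _) fun _ _ _ => by positivity
      _ ≤ _ := by
          rw [← Finset.mul_sum, Real.sqrt_mul (M0 _), hMm, hMm]
          exact mul_le_mul_of_nonneg_left (Real.sum_sqrt_mul_sqrt_le _
            (fun i => mul_nonneg (w0 i) (m0 _ _)) fun i => mul_nonneg (w0 i) (m0 _ _)) (by norm_num)
  have hgs : M t / 2 ≤ ∑ i ∈ good, w i * m i t := by
    have := Finset.sum_filter_add_sum_filter_not Finset.univ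
      (fun i => √t * m i t ^ (1 + 2 / (t : ℝ)) ≤ m i (t + 2)) (fun i => w i * m i t)
    rw [← hMm, ← hgood] at this
    linarith
  set p : ℝ := 1 + 2 / (t : ℝ) with hp
  have hp1 : 1 ≤ p := by rw [hp]; have : 0 ≤ 2 / (t : ℝ) := by positivity
                         linarith
  have hp0 : 0 < p := by linarith
  have hH := Real.inner_le_weight_mul_Lp_of_nonneg good hp1 w (fun i => m i t) w0 fun i => m0 i t
  have W0 : 0 ≤ ∑ i ∈ good, w i := Finset.sum_nonneg fun i _ => w0 i
  have Q0 : 0 ≤ ∑ i ∈ good, w i * m i t ^ p :=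
    Finset.sum_nonneg fun i _ => mul_nonneg (w0 i) (Real.rpow_nonneg (m0 i t) _)
  have h1 : (M t / 2) ^ p ≤ (∑ i ∈ good, w i) ^ (p - 1) * ∑ i ∈ good, w i * m i t ^ p := by
    calc (M t / 2) ^ p ≤ ((∑ i ∈ good, w i) ^ (1 - p⁻¹) *
          (∑ i ∈ good, w i * m i t ^ p) ^ p⁻¹) ^ p :=
          Real.rpow_le_rpow (by have := M0 t; positivity) (hgs.trans hH) hp0.le
      _ = _ := by
          rw [Real.mul_rpow (Real.rpow_nonneg W0 _) (Real.rpow_nonneg Q0 _),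
            ← Real.rpow_mul W0, ← Real.rpow_mul Q0, inv_mul_cancel₀ hp0.ne', Real.rpow_one]
          congr 2
          field_simp
  have h2 : ∑ i ∈ good, w i ≤ ∑ i, w i :=
    Finset.sum_le_sum_of_subset_of_nonneg (Finset.subset_univ _) fun i _ _ => w0 i
  have h3 : √t * ∑ i ∈ good, w i * m i t ^ p ≤ M (t + 2) := by
    rw [hMm, Finset.mul_sum]
    calc _ ≤ ∑ i ∈ good, w i * m i (t + 2) := by
          refine Finset.sum_le_sum fun i hi => ?_
          rw [mul_left_comm]
          exact mul_le_mul_of_nonneg_left (Finset.mem_filter.1 hi).2 (w0 i)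
      _ ≤ _ := Finset.sum_le_sum_of_subset_of_nonneg (Finset.subset_univ _) fun i _ _ =>
          mul_nonneg (w0 i) (m0 _ _)
  have hp2 : p - 1 = 2 / (t : ℝ) := by rw [hp]; ring
  rw [hp2] at h1
  calc √t * (M t / 2) ^ p
      ≤ √t * ((∑ i ∈ good, w i) ^ (2 / (t : ℝ)) * ∑ i ∈ good, w i * m i t ^ p) := by gcongr
    _ = (∑ i ∈ good, w i) ^ (2 / (t : ℝ)) * (√t * ∑ i ∈ good, w i * m i t ^ p) := by ring
    _ ≤ (∑ i, w i) ^ (2 / (t : ℝ)) * M (t + 2) :=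
        mul_le_mul (Real.rpow_le_rpow W0 h2 (by positivity)) h3
          (mul_nonneg (Real.sqrt_nonneg _) Q0) (Real.rpow_nonneg (W0.trans h2) _)

/-! ### Hamming weights along the walk -/

theorem hammingNorm_add_single {n : ℕ} (x : Fin n → ZMod 2) (i : Fin n) (h : x i = 0) :
    hammingNorm (x + Pi.single i 1) = hammingNorm x + 1 := by
  have e : (Finset.univ.filter fun j => (x + Pi.single i 1 : Fin n → ZMod 2) j ≠ 0) =
      insert i (Finset.univ.filter fun j => x j ≠ 0) := by
    ext j
    by_cases hj : j = i
    · subst hj; simp [h]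
    · simp [hj]
  rw [hammingNorm, hammingNorm, e, Finset.card_insert_of_notMem (by simp [h])]

theorem hammingNorm_add_single_le {n : ℕ} (x : Fin n → ZMod 2) (i : Fin n) :
    hammingNorm (x + Pi.single i 1) ≤ hammingNorm x + 1 := by
  refine (Finset.card_le_card fun j hj => ?_).trans
    (Finset.card_insert_le i (Finset.univ.filter fun j => x j ≠ 0))
  by_cases h : j = i
  · simp [h]
  · simpa [h] using hj

theorem cubeWalk_pow_nonneg (n t : ℕ) (x y : Fin n → ZMod 2) : 0 ≤ (cubeWalk n ^ t) x y :=
  pow_apply_nonneg (stepMatrix_nonneg _) t x y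

/-- The walk rarely repeats a coordinate. -/
theorem cubeWalk_collision_le {n : ℕ} (hn : n ≠ 0) (k t : ℕ) (x : Fin n → ZMod 2)
    (hx : hammingNorm x + t = k) :
    (cubeWalk n ^ t).mulVec (fun y => if hammingNorm y = k then 0 else 1) x ≤ t * k / n := by
  have hnR : (0 : ℝ) < n := by exact_mod_cast Nat.pos_of_ne_zero hn
  induction t generalizing x with
  | zero => simp at hx; simp [hx]
  | succ t ih =>
    rw [cubeWalk, stepMatrix_pow_succ_mulVec]
    refine div_le_div_of_nonneg_right ?_ hnR.le
    calc _ ≤ ∑ i : Fin n, ((t * k / n : ℝ) + if x i ≠ 0 then 1 else 0) := by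
          refine Finset.sum_le_sum fun i _ => ?_
          by_cases hi : x i = 0
          · have := ih (x + Pi.single i 1) (by rw [hammingNorm_add_single x i hi]; omega)
            simpa [hi, cubeWalk] using this
          · have h1 := mulVec_mono (cubeWalk_pow_nonneg n t)
              (f := fun y => if hammingNorm y = k then 0 else 1) (g := 1)
              (fun y => by simp only [Pi.one_apply]; split_ifs <;> norm_num) (x + Pi.single i 1)
            rw [cubeWalk, stepMatrix_pow_mulVec_one hn, Pi.one_apply] at h1
            have : (0 : ℝ) ≤ t * k / n := by positivity
            simp only [hi, ne_eq, not_false_eq_true, if_true]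
            linarith
      _ = t * k + hammingNorm x := by
          rw [Finset.sum_add_distrib, hammingNorm, Finset.sum_boole]
          simp
          field_simp
      _ ≤ _ := by
          have : (hammingNorm x : ℝ) ≤ k := by exact_mod_cast (by omega : hammingNorm x ≤ k)
          push_cast
          linarith

/-- A walk too short to reach the sphere of radius `k` only sees values off the sphere. -/
theorem cubeWalk_mulVec_le_of_lt {n : ℕ} (hn : n ≠ 0) {f : (Fin n → ZMod 2) → ℝ} {β : ℝ} {k : ℕ}
    (hf : ∀ x, hammingNorm x ≠ k → f x ≤ β) (t : ℕ) (x : Fin n → ZMod 2)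
    (hx : hammingNorm x + t < k) : (cubeWalk n ^ t).mulVec f x ≤ β := by
  have hnR : (0 : ℝ) < n := by exact_mod_cast Nat.pos_of_ne_zero hn
  induction t generalizing x with
  | zero => simpa using hf x (by omega)
  | succ t ih =>
    rw [cubeWalk, stepMatrix_pow_succ_mulVec, div_le_iff₀ hnR]
    calc _ ≤ ∑ i : Fin n, β := Finset.sum_le_sum fun i _ =>
          ih _ (by have := hammingNorm_add_single_le x i; omega)
      _ = _ := by simp [mul_comm]

theorem exists_hammingNorm_eq {n s : ℕ} (h : s ≤ n) : ∃ x : Fin n → ZMod 2, hammingNorm x = s := by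
  obtain ⟨A, hA⟩ := Finset.exists_subset_card_eq (s := (Finset.univ : Finset (Fin n))) (n := s)
    (by simpa using h)
  refine ⟨fun i => if i ∈ A then 1 else 0, ?_⟩
  rw [hammingNorm, ← hA.2]
  congr 1
  ext i
  simp

/-- Weight bound for a function that is at least `α` on the sphere of radius `k` and at most `β`
elsewhere. The walk starts at weight `k - t`. -/
theorem HasAffineWeight.sphere_bound {n : ℕ} {f : (Fin n → ZMod 2) → ℝ} {W : ℝ}
    (hf : HasAffineWeight f W) {k t s : ℕ} (ht : t = 2 ^ s) (htk : t ≤ k) (hkn : k ≤ n)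
    {α β : ℝ} (hα : ∀ x, hammingNorm x = k → α ≤ f x) (hβ : ∀ x, hammingNorm x ≠ k → f x ≤ β)
    (h0 : ∀ x, 0 ≤ f x) (h1 : ∀ x, f x ≤ 1) (hα0 : 0 ≤ α) (hβ0 : 0 ≤ β)
    {a b : ℝ} (ha0 : 0 ≤ a) (ha : a ≤ α * (1 - t * k / n)) (hb : β + (t + 2) * (k + 2) / n ≤ b)
    (hab : 6 * √(b * β) ≤ a) :
    √t * (a / 2) ^ (1 + 2 / (t : ℝ)) ≤ W ^ (2 / (t : ℝ)) * b := by
  have ht0 : 0 < t := by rw [ht]; positivity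
  have hn : n ≠ 0 := by omega
  obtain ⟨x, hx⟩ := exists_hammingNorm_eq (n := n) (s := k - t) (by omega)
  have W0 : 0 ≤ W := by
    obtain ⟨ι, _, w, A, w0, hA, rfl, -⟩ := hf
    exact Finset.sum_nonneg fun i _ => w0 i
  set M : ℕ → ℝ := fun j => (cubeWalk n ^ j).mulVec f x with hM
  have M0 : ∀ j, 0 ≤ M j := fun j =>
    Finset.sum_nonneg fun y _ => mul_nonneg (cubeWalk_pow_nonneg n j x y) (h0 y)
  have one : ∀ j, (cubeWalk n ^ j).mulVec 1 x = 1 := fun j => by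
    rw [cubeWalk, stepMatrix_pow_mulVec_one hn, Pi.one_apply]
  have lower : a ≤ M t := by
    have c := cubeWalk_collision_le hn k t x (by omega)
    set g : (Fin n → ZMod 2) → ℝ := fun y => if hammingNorm y = k then 0 else 1 with hg
    have := mulVec_mono (cubeWalk_pow_nonneg n t) (f := α • ((1 : (Fin n → ZMod 2) → ℝ) - g)) (g := f)
      (fun y => by
        simp only [hg, Pi.smul_apply, Pi.sub_apply, Pi.one_apply, smul_eq_mul]
        split_ifs with h
        · simpa using hα y h
        · simpa using h0 y) x
    rw [Matrix.mulVec_smul, Matrix.mulVec_sub, Pi.smul_apply, Pi.sub_apply, one,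
      smul_eq_mul] at this
    have := mul_le_mul_of_nonneg_left c hα0
    simp only [hM]
    linarith
  have upper : M (t + 2) ≤ b := by
    have c := cubeWalk_collision_le hn (k + 2) (t + 2) x (by omega)
    set g : (Fin n → ZMod 2) → ℝ := fun y => if hammingNorm y = k + 2 then 0 else 1 with hg
    have := mulVec_mono (cubeWalk_pow_nonneg n (t + 2)) (f := f) (g := β • (1 : (Fin n → ZMod 2) → ℝ) + g)
      (fun y => by
        simp only [hg, Pi.smul_apply, Pi.add_apply, Pi.one_apply, smul_eq_mul]
        split_ifs with h
        · simpa using hβ y (by omega)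
        · linarith [h1 y]) x
    rw [Matrix.mulVec_add, Matrix.mulVec_smul, Pi.add_apply, Pi.smul_apply, one,
      smul_eq_mul] at this
    simp only [hM]
    push_cast at c
    linarith
  -- for `t = 1` the truncated `t - 2 = 0` is still a time before the sphere is reached
  have short : M (t - 2) ≤ β := cubeWalk_mulVec_le_of_lt hn hβ (t - 2) x (by omega)
  have key := hf.le_of_overlap_le x ht hM (by
    refine le_trans ?_ (hab.trans lower)
    have := mul_le_mul upper short (M0 _) ((M0 _).trans upper)
    gcongr)
  calc _ ≤ √t * (M t / 2) ^ (1 + 2 / (t : ℝ)) := by gcongr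
    _ ≤ _ := key
    _ ≤ _ := by gcongr

/-! ### Leaves of a parity decision tree -/

namespace ParityTree

open Classical in
/-- The number of leaves labelled `1` whose set of inputs, among those in `C`, is `A`. -/
noncomputable def leafCount {n : ℕ} :
    ParityTree n → Set (Fin n → ZMod 2) → Set (Fin n → ZMod 2) → ℝ≥0∞
  | leaf b, C, A => if b = true ∧ A = C then 1 else 0
  | node y l r, C, A =>
      l.leafCount (C ∩ {x | dotProduct x y = 0}) A + r.leafCount (C ∩ {x | dotProduct x y = 1}) A

theorem dotProduct_eq_one_iff {n : ℕ} (x y : Fin n → ZMod 2) :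
    dotProduct x y = 1 ↔ dotProduct x y ≠ 0 := by
  generalize dotProduct x y = c
  revert c
  decide

/-- The inputs in `C` that a tree accepts are partitioned by its accepting leaves. -/
theorem sum_leafCount_mul_indicator {n : ℕ} (T : ParityTree n) (C : Set (Fin n → ZMod 2))
    (x : Fin n → ZMod 2) :
    ∑ A, T.leafCount C A * A.indicator 1 x = C.indicator 1 x * if T.eval x = true then 1 else 0 := by
  classical
  induction T generalizing C with
  | leaf b => cases b <;> simp [leafCount, eval]
  | node y l r hl hr =>
    simp only [leafCount, add_mul, Finset.sum_add_distrib, hl, hr, eval]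
    by_cases h : dotProduct x y = 0
    · simp [h, Set.indicator_apply]
    · have h' := (dotProduct_eq_one_iff x y).2 h
      simp [h', Set.indicator_apply]

theorem sum_leafCount_le_size {n : ℕ} (T : ParityTree n) (C : Set (Fin n → ZMod 2)) :
    ∑ A, T.leafCount C A ≤ T.size := by
  classical
  induction T generalizing C with
  | leaf b => cases b <;> simp [leafCount, size]
  | node y l r hl hr =>
    simp only [leafCount, Finset.sum_add_distrib, size]
    push_cast
    exact (add_le_add (hl _) (hr _)).trans le_self_add

theorem isFiber_of_leafCount_ne_zero {n : ℕ} (T : ParityTree n) {C A : Set (Fin n → ZMod 2)}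
    (hC : IsFiber C) (h : T.leafCount C A ≠ 0) : IsFiber A := by
  induction T generalizing C with
  | leaf b =>
    have : b = true ∧ A = C := by
      by_contra hn
      exact h (if_neg hn)
    rwa [this.2]
  | node y l r hl hr =>
    rw [leafCount, ne_eq, add_eq_zero, not_and_or] at h
    rcases h with h | h
    · exact hl (hC.inter (isFiber_dotProduct y 0)) h
    · exact hr (hC.inter (isFiber_dotProduct y 1)) h

theorem one_le_size {n : ℕ} (T : ParityTree n) : 1 ≤ T.size := by
  cases T <;> simp [size]

theorem three_le_size_of_eval_ne {n : ℕ} (T : ParityTree n) {x y : Fin n → ZMod 2}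
    (h : T.eval x ≠ T.eval y) : 3 ≤ T.size := by
  cases T with
  | leaf b => exact absurd rfl h
  | node y l r => simp only [size]; have := l.one_le_size; have := r.one_le_size; omega

end ParityTree

namespace RandomizedParityTree

open Classical in
theorem map_eval_apply {n : ℕ} (ν : RandomizedParityTree n) (x : Fin n → ZMod 2) (b : Bool) :
    (PMF.map (fun T => T.eval x) ν) b = ∑' T, ν T * if T.eval x = b then 1 else 0 := by
  rw [PMF.map_apply]
  refine tsum_congr fun T => ?_
  by_cases h : T.eval x = b
  · simp [h]
  · simp [h, Ne.symm h]

theorem map_eval_add {n : ℕ} (ν : RandomizedParityTree n) (x : Fin n → ZMod 2) :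
    (PMF.map (fun T => T.eval x) ν) true + (PMF.map (fun T => T.eval x) ν) false = 1 := by
  have := (PMF.map (fun T => T.eval x) ν).tsum_coe
  rwa [tsum_fintype, Fintype.sum_bool] at this

theorem expectedSize_le_maxSize {n : ℕ} (ν : RandomizedParityTree n) :
    expectedSize ν ≤ maxSize ν := by
  calc expectedSize ν ≤ ∑' T, ν T * maxSize ν := by
        refine ENNReal.tsum_le_tsum fun T => ?_
        by_cases h : ν T = 0
        · simp [h]
        · gcongr
          exact le_iSup₂ (f := fun (T : ParityTree n) (_ : T ∈ PMF.support ν) => (T.size : ℝ≥0∞))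
            T ((PMF.mem_support_iff ν T).2 h)
    _ = maxSize ν := by rw [ENNReal.tsum_mul_right, ν.tsum_coe, one_mul]

/-- The acceptance probability is a combination of affine subspaces, weighted by the expected number
of accepting leaves that belong to them. -/
theorem exists_hasAffineWeight {n : ℕ} (ν : RandomizedParityTree n) (hE : expectedSize ν ≠ ∞) :
    ∃ W ≤ (expectedSize ν).toReal, HasAffineWeight
      (fun x => ((PMF.map (fun T => T.eval x) ν) true).toReal) W := by
  classical
  set w : Set (Fin n → ZMod 2) → ℝ≥0∞ := fun A => ∑' T, ν T * T.leafCount Set.univ A with hw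
  have hwE : ∑ A, w A ≤ expectedSize ν := by
    rw [hw, ← Summable.tsum_finsetSum fun _ _ => ENNReal.summable]
    refine ENNReal.tsum_le_tsum fun T => ?_
    rw [← Finset.mul_sum]
    gcongr
    exact T.sum_leafCount_le_size _
  have hfin : ∀ A, w A ≠ ∞ := fun A => ne_top_of_le_ne_top hE
    ((Finset.single_le_sum (f := w) (fun _ _ => zero_le) (Finset.mem_univ A)).trans hwE)
  have hfib : ∀ A, w A ≠ 0 → IsFiber A := by
    intro A hA
    obtain ⟨T, hT⟩ : ∃ T, ν T * T.leafCount Set.univ A ≠ 0 := by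
      by_contra! h
      exact hA (ENNReal.tsum_eq_zero.2 h)
    exact T.isFiber_of_leafCount_ne_zero isFiber_univ (right_ne_zero_of_mul hT)
  refine ⟨∑ A, (w A).toReal, ?_, Set (Fin n → ZMod 2), inferInstance, fun A => (w A).toReal,
    fun A => if IsFiber A then A else Set.univ, fun A => ENNReal.toReal_nonneg, fun A => ?_, rfl,
    fun x => ?_⟩
  · rw [← ENNReal.toReal_sum fun A _ => hfin A]
    exact ENNReal.toReal_mono hE hwE
  · dsimp only
    split_ifs with h
    exacts [h, isFiber_univ]
  · have e : (PMF.map (fun T => T.eval x) ν) true = ∑ A, w A * A.indicator 1 x := by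
      rw [map_eval_apply]
      simp only [hw, ← ENNReal.tsum_mul_right]
      rw [← Summable.tsum_finsetSum fun _ _ => ENNReal.summable]
      refine tsum_congr fun T => ?_
      have := T.sum_leafCount_mul_indicator Set.univ x
      simp only [Set.indicator_univ, Pi.one_apply, one_mul] at this
      simp only [mul_assoc]
      rw [← Finset.mul_sum, this]
    dsimp only
    rw [e, ENNReal.toReal_sum]
    · refine Finset.sum_congr rfl fun A _ => ?_
      rw [ENNReal.toReal_mul]
      by_cases hA : w A = 0
      · simp [hA]
      · rw [if_pos (hfib A hA)]
        congr 1
        by_cases hx : x ∈ A <;> simp [hx]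
    · intro A _
      by_cases hx : x ∈ A <;> simp [hx, hfin A]

/-- A tree that takes two different values has at least three nodes. -/
theorem three_sub_le_expectedSize {n : ℕ} (ν : RandomizedParityTree n) {x y : Fin n → ZMod 2}
    {δ : ℝ} (hδ : 0 ≤ δ) (hx : (PMF.map (fun T => T.eval x) ν) false ≤ ENNReal.ofReal δ)
    (hy : (PMF.map (fun T => T.eval y) ν) true ≤ ENNReal.ofReal δ) :
    ENNReal.ofReal (3 - 4 * δ) ≤ expectedSize ν := by
  classical
  have h : (3 : ℝ≥0∞) ≤ expectedSize ν + (2 * ENNReal.ofReal δ + 2 * ENNReal.ofReal δ) := by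
    calc (3 : ℝ≥0∞) = ∑' T, ν T * 3 := by rw [ENNReal.tsum_mul_right, ν.tsum_coe, one_mul]
      _ ≤ ∑' T, (ν T * T.size + (2 * (ν T * if T.eval x = false then 1 else 0) +
            2 * (ν T * if T.eval y = true then 1 else 0))) := by
          refine ENNReal.tsum_le_tsum fun T => ?_
          have e : ν T * T.size + (2 * (ν T * if T.eval x = false then 1 else 0) +
            2 * (ν T * if T.eval y = true then 1 else 0)) = ν T * (T.size +
              ((if T.eval x = false then 2 else 0) + (if T.eval y = true then 2 else 0))) := by
            split_ifs <;> ring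
          rw [e]
          gcongr
          have h1 : (1 : ℝ≥0∞) ≤ T.size := by exact_mod_cast T.one_le_size
          by_cases hx : T.eval x = false
          · calc (3 : ℝ≥0∞) = 1 + (2 + 0) := by norm_num
              _ ≤ _ := by rw [if_pos hx]; gcongr; exact zero_le
          by_cases hy : T.eval y = true
          · calc (3 : ℝ≥0∞) = 1 + (0 + 2) := by norm_num
              _ ≤ _ := by rw [if_pos hy]; gcongr; exact zero_le
          have h3 : (3 : ℝ≥0∞) ≤ T.size := by
            exact_mod_cast T.three_le_size_of_eval_ne (x := x) (y := y) (by simp_all)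
          exact h3.trans le_self_add
      _ ≤ _ := by
          rw [ENNReal.tsum_add, ENNReal.tsum_add, ENNReal.tsum_mul_left, ENNReal.tsum_mul_left,
            ← map_eval_apply, ← map_eval_apply]
          exact add_le_add le_rfl (by gcongr)
  have e : (2 * ENNReal.ofReal δ + 2 * ENNReal.ofReal δ) = ENNReal.ofReal (4 * δ) := by
    rw [← add_mul, ENNReal.ofReal_mul (by norm_num)]
    norm_num
  rw [e] at h
  rw [ENNReal.ofReal_sub _ (by positivity), tsub_le_iff_right]
  simpa using h

end RandomizedParityTree

/-! ### The lower bound for functions peaked on a sphere -/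

theorem exp_le_of_exp_le_rpow {y W t : ℝ} (ht : 0 < t) (hW : 0 ≤ W)
    (h : Real.exp y ≤ W ^ (2 / t)) : Real.exp (y * (t / 2)) ≤ W := by
  have := Real.rpow_le_rpow (Real.exp_pos y).le h (show 0 ≤ t / 2 by positivity)
  rwa [← Real.exp_mul, ← Real.rpow_mul hW, div_mul_div_cancel₀ (by positivity),
    div_self (by norm_num), Real.rpow_one] at this

theorem exists_two_pow_le_lt {y : ℕ} (hy : 1 ≤ y) : ∃ s, 2 ^ s ≤ y ∧ y < 2 * 2 ^ s :=
  ⟨Nat.log 2 y, Nat.pow_log_le_self 2 (by omega), by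
    have := Nat.lt_pow_succ_log_self (b := 2) (by norm_num) y
    rwa [pow_succ, mul_comm] at this⟩

/-- The exponent `1 + 2 / t` is at most `3`. -/
theorem pow_three_le_rpow {a t : ℝ} (ha0 : 0 < a) (ha1 : a ≤ 1) (ht : 1 ≤ t) :
    a ^ 3 ≤ a ^ (1 + 2 / t) := by
  rw [← Real.rpow_natCast]
  refine Real.rpow_le_rpow_of_exponent_ge ha0 ha1 ?_
  have : 2 / t ≤ 2 := div_le_self (by norm_num) ht
  push_cast
  linarith

theorem HasAffineWeight.nonneg {n : ℕ} {f : (Fin n → ZMod 2) → ℝ} {W : ℝ}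
    (hf : HasAffineWeight f W) : 0 ≤ W := by
  obtain ⟨ι, _, w, A, w0, hA, rfl, -⟩ := hf
  exact Finset.sum_nonneg fun i _ => w0 i

/-- The lower bound for small errors. -/
theorem HasAffineWeight.exp_le_of_error_small {n : ℕ} {f : (Fin n → ZMod 2) → ℝ} {W : ℝ}
    (hf : HasAffineWeight f W) {k : ℕ} {δ : ℝ} (hk : 1 ≤ k) (hδ : 0 < δ) (hδ' : δ ≤ 1 / 640 ^ 2)
    (hkn : (k : ℝ) ^ 2 < δ * n) (hα : ∀ x, hammingNorm x = k → 1 - δ ≤ f x)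
    (hβ : ∀ x, hammingNorm x ≠ k → f x ≤ δ) (h0 : ∀ x, 0 ≤ f x) (h1 : ∀ x, f x ≤ 1) :
    Real.exp (1 / 16 * (k * Real.log (k / δ))) ≤ W := by
  obtain ⟨s, hs1, hs2⟩ := exists_two_pow_le_lt hk
  obtain ⟨t, ht⟩ : ∃ t, t = 2 ^ s := ⟨_, rfl⟩
  rw [← ht] at hs1 hs2
  have ht1 : 1 ≤ t := by rw [ht]; exact Nat.one_le_two_pow
  have htR : (1 : ℝ) ≤ t := by exact_mod_cast ht1
  have hkR : (1 : ℝ) ≤ k := by exact_mod_cast hk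
  have htk : (t : ℝ) ≤ k := by exact_mod_cast hs1
  have hkt : (k : ℝ) ≤ 2 * t := by exact_mod_cast hs2.le
  have hd : δ ≤ 1 / 1000 := hδ'.trans (by norm_num)
  have hn : (0 : ℝ) < n := by
    by_contra h
    have : (n : ℝ) = 0 := le_antisymm (not_lt.1 h) (Nat.cast_nonneg n)
    rw [this] at hkn
    nlinarith
  have hkn' : k ≤ n := by
    have : (k : ℝ) ≤ n := by nlinarith
    exact_mod_cast this
  have key := hf.sphere_bound ht hs1 hkn' hα hβ h0 h1 (by linarith) hδ.le (a := 1 / 2)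
    (b := 10 * δ) (by norm_num) ?_ ?_ ?_
  rotate_left
  · have : (t : ℝ) * k / n ≤ δ := by
      rw [div_le_iff₀ hn]; nlinarith
    nlinarith
  · have : ((t : ℝ) + 2) * (k + 2) / n ≤ 9 * δ := by
      rw [div_le_iff₀ hn]; nlinarith
    linarith
  · rw [mul_assoc, Real.sqrt_mul (by norm_num), Real.sqrt_mul_self hδ.le]
    have : √10 ≤ 4 := by rw [Real.sqrt_le_left (by norm_num)]; norm_num
    nlinarith
  have hW := hf.nonneg
  have h2 := pow_three_le_rpow (a := 1 / 2 / 2) (by norm_num) (by norm_num) htR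
  have h3 : √t / (640 * δ) ≤ W ^ (2 / (t : ℝ)) := by
    rw [div_le_iff₀ (by positivity)]
    have := mul_le_mul_of_nonneg_left h2 (Real.sqrt_nonneg t)
    norm_num at this
    norm_num at key
    linarith
  have hL : 0 ≤ Real.log (k / δ) := by
    apply Real.log_nonneg
    rw [le_div_iff₀ hδ]; linarith
  -- half of the exponent of `1 / δ` pays for the constant `640`
  have h4 : Real.exp (Real.log (k / δ) / 4) ≤ √t / (640 * δ) := by
    rw [← Real.le_log_iff_exp_le (by positivity), Real.log_div (by positivity) (by positivity),
      Real.log_div (by positivity) (by positivity), Real.log_sqrt (by positivity),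
      Real.log_mul (by norm_num) (by positivity)]
    have a1 : Real.log k ≤ Real.log 2 + Real.log t := by
      rw [← Real.log_mul (by norm_num) (by positivity)]
      exact Real.log_le_log (by positivity) hkt
    have a2 : Real.log δ ≤ - (2 * Real.log 640) := by
      have := Real.log_le_log hδ hδ'
      rw [one_div, Real.log_inv, Real.log_pow] at this
      exact_mod_cast this
    have a5 : 0 < Real.log 640 := Real.log_pos (by norm_num)
    have a3 : Real.log 2 ≤ Real.log 640 := Real.log_le_log (by norm_num) (by norm_num)
    have a4 := Real.log_nonneg htR
    linarith
  have h5 := exp_le_of_exp_le_rpow (by positivity) hW (h4.trans h3)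
  refine le_trans (Real.exp_le_exp.2 ?_) h5
  nlinarith

/-- The lower bound for errors bounded away from `1 / 2`, when `k` is large: a power of `f`
separates the sphere from its complement well. -/
theorem exists_exp_le_of_large {δ₁ : ℝ} (h₁ : 0 < δ₁) (h₁' : δ₁ < 1 / 2) :
    ∃ c > 0, ∃ K ≥ 1, ∀ (n : ℕ) (f : (Fin n → ZMod 2) → ℝ) (W : ℝ), HasAffineWeight f W →
      ∀ (k : ℕ) (δ : ℝ), K ≤ (k : ℝ) → 1 / 640 ^ 2 ≤ δ → δ ≤ δ₁ → (k : ℝ) ^ 2 < δ * n →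
      (∀ x, hammingNorm x = k → 1 - δ ≤ f x) → (∀ x, hammingNorm x ≠ k → f x ≤ δ) →
      (∀ x, 0 ≤ f x) → (∀ x, f x ≤ 1) → Real.exp (c * (k * Real.log (k / δ))) ≤ W := by
  -- the exponent is positive, as needed to extract an `r`-th root at the end
  obtain ⟨r₀, hr₀⟩ := exists_pow_lt_of_lt_one (show (0 : ℝ) < 1 / 24 by norm_num)
    (show δ₁ / (1 - δ₁) < 1 by rw [div_lt_one (by linarith)]; linarith)
  obtain ⟨r, hr⟩ : ∃ r, r = r₀ + 1 := ⟨_, rfl⟩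
  have hr1 : (1 : ℝ) ≤ r := by rw [hr]; push_cast; have : (0 : ℝ) ≤ r₀ := Nat.cast_nonneg _
                               linarith
  set α : ℝ := (1 - δ₁) ^ r with hα
  set β : ℝ := δ₁ ^ r with hβ
  have α0 : 0 < α := pow_pos (by linarith) _
  have α1 : α ≤ 1 := pow_le_one₀ (by linarith) (by linarith)
  have β0 : 0 < β := pow_pos h₁ _
  have hβα : 24 * β ≤ α := by
    have h1 : (δ₁ / (1 - δ₁)) ^ r ≤ 1 / 24 := by
      have : 0 ≤ δ₁ / (1 - δ₁) := div_nonneg h₁.le (by linarith)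
      refine le_trans ?_ hr₀.le
      rw [hr]
      exact pow_le_pow_of_le_one this (by rw [div_le_one (by linarith)]; linarith) (by omega)
    rw [div_pow, div_le_iff₀ α0] at h1
    linarith
  -- the walk takes about `k / m` steps, so that its collision probability is at most `β`
  obtain ⟨m, hm⟩ := exists_nat_ge (9 / β)
  have hm9 : 9 ≤ β * m := by rwa [div_le_iff₀' β0] at hm
  have hm0 : 0 < m := by
    rcases Nat.eq_zero_or_pos m with h | h
    · rw [h] at hm9; norm_num at hm9
    · exact h
  have hm1 : (1 : ℝ) ≤ m := by exact_mod_cast hm0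
  set κ : ℝ := (α / 4) ^ 3 with hκ
  have κ0 : 0 < κ := by positivity
  set K : ℝ := max m (4 * m ^ 2 * 640 ^ 2 / κ ^ 4) with hK
  refine ⟨1 / (16 * m * r), by positivity, K, hm1.trans (le_max_left _ _), ?_⟩
  intro n f W hf k δ hKk hδ hδδ₁ hkn hfα hfβ h0 h1
  have hδ0 : 0 < δ := lt_of_lt_of_le (by norm_num) hδ
  have hmk : (m : ℝ) ≤ k := (le_max_left _ _).trans hKk
  have hk1 : (1 : ℝ) ≤ k := hm1.trans hmk
  have hmkN : m ≤ k := by exact_mod_cast hmk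
  obtain ⟨s, hs1, hs2⟩ := exists_two_pow_le_lt (Nat.div_pos hmkN hm0)
  obtain ⟨t, ht⟩ : ∃ t, t = 2 ^ s := ⟨_, rfl⟩
  rw [← ht] at hs1 hs2
  have ht1 : 1 ≤ t := by rw [ht]; exact Nat.one_le_two_pow
  have htR : (1 : ℝ) ≤ t := by exact_mod_cast ht1
  have htmk : (t : ℝ) * m ≤ k := by
    exact_mod_cast (Nat.mul_le_mul_right m hs1).trans (Nat.div_mul_le_self k m)
  have hkt : (k : ℝ) ≤ 2 * m * t := by
    have h1 : k < m * (k / m + 1) := Nat.lt_mul_div_succ k hm0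
    have h2 : m * (k / m + 1) ≤ m * (2 * t) := Nat.mul_le_mul_left m hs2
    have : k ≤ m * (2 * t) := (h1.trans_le h2).le
    have h3 : (k : ℝ) ≤ m * (2 * t) := by exact_mod_cast this
    linarith
  have hn : (0 : ℝ) < n := by
    by_contra h
    have : (n : ℝ) = 0 := le_antisymm (not_lt.1 h) (Nat.cast_nonneg n)
    rw [this, mul_zero] at hkn
    exact absurd hkn (not_lt.2 (sq_nonneg _))
  have hkn' : k ≤ n := by
    have : (k : ℝ) ≤ n := (le_self_pow₀ hk1 two_ne_zero).trans
      (hkn.le.trans (mul_le_of_le_one_left hn.le (by linarith)))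
    exact_mod_cast this
  have htk : (t : ℝ) ≤ k := (le_mul_of_one_le_right (by positivity) hm1).trans htmk
  have key := (hf.pow r).sphere_bound ht (by exact_mod_cast htk) hkn'
    (fun x hx => pow_le_pow_left₀ (by linarith) (le_trans (by linarith) (hfα x hx)) r :
      ∀ x, hammingNorm x = k → α ≤ (f ^ r) x)
    (fun x hx => pow_le_pow_left₀ (h0 x) ((hfβ x hx).trans hδδ₁) r :
      ∀ x, hammingNorm x ≠ k → (f ^ r) x ≤ β)
    (fun x => pow_nonneg (h0 x) r) (fun x => pow_le_one₀ (h0 x) (h1 x)) α0.le β0.le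
    (a := α / 2) (b := 2 * β) (by positivity) ?_ ?_ ?_
  rotate_left
  · have : (t : ℝ) * k / n ≤ 1 / 2 := by
      rw [div_le_iff₀ hn]
      have e1 := mul_le_mul_of_nonneg_right htk (show (0 : ℝ) ≤ k by linarith)
      have e2 := mul_le_mul_of_nonneg_right (hδδ₁.trans h₁'.le) hn.le
      linarith [sq (k : ℝ)]
    have := mul_le_mul_of_nonneg_left this α0.le
    linarith
  · have : ((t : ℝ) + 2) * (k + 2) / n ≤ β := by
      rw [div_le_iff₀ hn]
      have e1 : ((t : ℝ) + 2) * (k + 2) ≤ 9 * (t * k) := by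
        have := mul_le_mul (show (t : ℝ) + 2 ≤ 3 * t by linarith)
          (show (k : ℝ) + 2 ≤ 3 * k by linarith) (by positivity) (by positivity)
        linarith
      have e2 : 9 * ((t : ℝ) * k) ≤ β * (t * m) * k := by
        have := mul_le_mul_of_nonneg_right hm9 (show (0 : ℝ) ≤ t * k by positivity)
        linarith
      have e3 : β * (t * m) * k ≤ β * k ^ 2 := by
        have := mul_le_mul_of_nonneg_left htmk (show (0 : ℝ) ≤ β * k by positivity)
        linarith
      have e4 : (k : ℝ) ^ 2 ≤ n :=
        hkn.le.trans (mul_le_of_le_one_left hn.le (by linarith))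
      have := mul_le_mul_of_nonneg_left e4 β0.le
      linarith
    linarith
  · rw [mul_assoc, Real.sqrt_mul (by norm_num), Real.sqrt_mul_self β0.le]
    have : √2 ≤ 2 := by rw [Real.sqrt_le_left (by norm_num)]; norm_num
    have := mul_le_mul_of_nonneg_right this β0.le
    linarith
  have hW := hf.nonneg
  have h2 := pow_three_le_rpow (a := α / 2 / 2) (by positivity) (by linarith) htR
  have h3 : √t * κ ≤ (W ^ r) ^ (2 / (t : ℝ)) := by
    have e1 := mul_le_mul_of_nonneg_left h2 (Real.sqrt_nonneg t)
    have e2 : (W ^ r) ^ (2 / (t : ℝ)) * (2 * β) ≤ (W ^ r) ^ (2 / (t : ℝ)) * 1 :=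
      mul_le_mul_of_nonneg_left (by linarith) (Real.rpow_nonneg (pow_nonneg hW r) _)
    rw [show α / 2 / 2 = α / 4 by ring] at e1 key
    rw [hκ]
    linarith
  have hL : 0 ≤ Real.log (k / δ) := by
    apply Real.log_nonneg
    rw [le_div_iff₀ hδ0]; linarith
  have h4 : Real.exp (Real.log (k / δ) / 4) ≤ √t * κ := by
    have hk2 := (le_max_right _ _).trans hKk
    have b1 := Real.log_le_log (by positivity) hk2
    rw [Real.log_div (by positivity) (by positivity), Real.log_mul (by positivity) (by positivity),
      Real.log_mul (by positivity) (by positivity), Real.log_pow, Real.log_pow, Real.log_pow] at b1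
    have b2 := Real.log_le_log (by positivity) hkt
    rw [Real.log_mul (by positivity) (by positivity),
      Real.log_mul (by positivity) (by positivity)] at b2
    have b3 := Real.log_le_log (by positivity) hδ
    rw [one_div, Real.log_inv, Real.log_pow] at b3
    have b4 : Real.log 4 = 2 * Real.log 2 := by
      rw [show (4 : ℝ) = 2 ^ 2 by norm_num, Real.log_pow]; push_cast; ring
    rw [← Real.le_log_iff_exp_le (by positivity), Real.log_mul (by positivity) (by positivity),
      Real.log_div (by positivity) (by positivity), Real.log_sqrt (by positivity)]
    push_cast at b1 b3
    linarith
  have h5 := exp_le_of_exp_le_rpow (by positivity) (pow_nonneg hW r) (h4.trans h3)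
  have h6 : Real.exp (1 / (16 * m * r) * (k * Real.log (k / δ))) ^ r ≤ W ^ r := by
    refine le_trans ?_ h5
    rw [← Real.exp_nat_mul, Real.exp_le_exp]
    have : (r : ℝ) * (1 / (16 * m * r) * (k * Real.log (k / δ))) =
        k * Real.log (k / δ) / (16 * m) := by field_simp
    rw [this, div_le_iff₀ (by positivity)]
    have := mul_le_mul_of_nonneg_right hkt hL
    linarith
  exact le_of_pow_le_pow_left₀ (by omega) hW h6

/-! ### Parity decision trees for the Hamming weight -/

theorem theorem6 (δ₁ : ℝ) (hδ₁ : δ₁ < 1 / 2) :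
    ∃ c : ℝ, 0 < c ∧
      ∀ (n k : ℕ) (δ : ℝ), 1 ≤ k → 0 < δ → δ ≤ δ₁ → (k : ℝ) ^ 2 < δ * (n : ℝ) →
        ∀ ν : RandomizedParityTree n,
          RandomizedParityTree.DecidesWithError ν δ (hammingWeightEq n k) →
            ENNReal.ofReal (Real.exp (c * ((k : ℝ) * Real.log ((k : ℝ) / δ))))
                ≤ RandomizedParityTree.maxSize ν ∧
            ENNReal.ofReal (Real.exp (c * ((k : ℝ) * Real.log ((k : ℝ) / δ))))
                ≤ RandomizedParityTree.expectedSize ν := by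
  rcases le_or_gt δ₁ 0 with h | h₁
  -- no `δ` is admissible
  · exact ⟨1, one_pos, fun n k δ _ h0 h1 => absurd (h0.trans_le h1) (not_lt.2 h)⟩
  obtain ⟨c₁, hc₁, K, hK, large⟩ := exists_exp_le_of_large h₁ hδ₁
  have hl3 : 0 < Real.log (3 - 4 * δ₁) := Real.log_pos (by linarith)
  have hK0 : 0 ≤ Real.log (K * 640 ^ 2) := Real.log_nonneg (by nlinarith)
  have hK1 : 0 < K * Real.log (K * 640 ^ 2) + 1 := by positivity
  refine ⟨min (1 / 16) (min c₁ (Real.log (3 - 4 * δ₁) / (K * Real.log (K * 640 ^ 2) + 1))),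
    by positivity, ?_⟩
  intro n k δ hk hδ hδδ₁ hkn ν hν
  refine (fun h => ⟨h.trans ν.expectedSize_le_maxSize, h⟩ : _ → _ ∧ _) ?_
  set c := min (1 / 16) (min c₁ (Real.log (3 - 4 * δ₁) / (K * Real.log (K * 640 ^ 2) + 1))) with hc
  have hkR : (1 : ℝ) ≤ k := by exact_mod_cast hk
  have hL : 0 ≤ k * Real.log (k / δ) := by
    refine mul_nonneg (by linarith) (Real.log_nonneg ?_)
    rw [le_div_iff₀ hδ]; linarith
  by_cases hE : RandomizedParityTree.expectedSize ν = ∞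
  · rw [hE]; exact le_top
  -- the probabilities of the two outputs
  have hsum := ν.map_eval_add
  have hfin : ∀ x b, (PMF.map (fun T => ParityTree.eval T x) ν) b ≠ ∞ := fun x b =>
    PMF.apply_ne_top _ _
  have htrue : ∀ x, hammingNorm x = k →
      ENNReal.ofReal (1 - δ) ≤ (PMF.map (fun T => ParityTree.eval T x) ν) true := by
    intro x hx
    simpa [hammingWeightEq, hx] using hν x
  have hfalse : ∀ x, hammingNorm x ≠ k →
      ENNReal.ofReal (1 - δ) ≤ (PMF.map (fun T => ParityTree.eval T x) ν) false := by
    intro x hx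
    simpa [hammingWeightEq, hx] using hν x
  have compl : ∀ p q : ℝ≥0∞, p + q = 1 → ENNReal.ofReal (1 - δ) ≤ p → q ≤ ENNReal.ofReal δ := by
    intro p q hpq hp
    have hp' : p ≠ ∞ := fun h => by simp [h] at hpq
    have hone : (1 : ℝ≥0∞) = ENNReal.ofReal (1 - δ) + ENNReal.ofReal δ := by
      rw [← ENNReal.ofReal_add (by linarith) hδ.le]; simp
    have : p + q ≤ p + ENNReal.ofReal δ := by
      rw [hpq, hone]; gcongr
    exact (ENNReal.add_le_add_iff_left hp').1 this
  obtain ⟨W, hWE, hf⟩ := ν.exists_hasAffineWeight hE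
  set f : (Fin n → ZMod 2) → ℝ :=
    fun x => ((PMF.map (fun T => ParityTree.eval T x) ν) true).toReal with hfdef
  have hα : ∀ x, hammingNorm x = k → 1 - δ ≤ f x := fun x hx =>
    (ENNReal.ofReal_le_iff_le_toReal (hfin x true)).1 (htrue x hx)
  have hβ : ∀ x, hammingNorm x ≠ k → f x ≤ δ := fun x hx =>
    ENNReal.toReal_le_of_le_ofReal hδ.le
      (compl _ _ ((add_comm _ _).trans (hsum x)) (hfalse x hx))
  have h0 : ∀ x, 0 ≤ f x := fun x => ENNReal.toReal_nonneg
  have h1 : ∀ x, f x ≤ 1 := fun x =>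
    ENNReal.toReal_le_of_le_ofReal zero_le_one (by rw [ENNReal.ofReal_one]; exact PMF.coe_le_one _ _)
  have mono : ∀ c', c ≤ c' → Real.exp (c' * (k * Real.log (k / δ))) ≤ W →
      ENNReal.ofReal (Real.exp (c * (k * Real.log (k / δ)))) ≤
        RandomizedParityTree.expectedSize ν := by
    intro c' hcc h
    rw [ENNReal.ofReal_le_iff_le_toReal hE]
    refine le_trans (Real.exp_le_exp.2 ?_) (h.trans hWE)
    exact mul_le_mul_of_nonneg_right hcc hL
  rcases le_total δ (1 / 640 ^ 2) with hδs | hδs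
  · exact mono _ (min_le_left _ _) (hf.exp_le_of_error_small hk hδ hδs hkn hα hβ h0 h1)
  rcases le_total K k with hKk | hKk
  · exact mono _ ((min_le_right _ _).trans (min_le_left _ _))
      (large n f W hf k δ hKk hδs hδδ₁ hkn hα hβ h0 h1)
  -- only bounded `k` remain, and the size is at least `3 - 4 δ₁ > 1`
  have hkn' : k ≤ n := by
    have : (k : ℝ) ≤ n := by
      have : (0 : ℝ) ≤ n := Nat.cast_nonneg n
      nlinarith
    exact_mod_cast this
  obtain ⟨x, hx⟩ := exists_hammingNorm_eq hkn'
  have h3 := ν.three_sub_le_expectedSize (x := x) (y := 0) hδ.le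
    (compl _ _ (hsum x) (htrue x hx))
    (compl _ _ ((add_comm _ _).trans (hsum 0)) (hfalse 0 (by rw [hammingNorm_zero]; omega)))
  refine le_trans (ENNReal.ofReal_le_ofReal ?_) h3
  rw [← Real.le_log_iff_exp_le (by linarith)]
  have e1 : k * Real.log (k / δ) ≤ K * Real.log (K * 640 ^ 2) := by
    refine mul_le_mul hKk (Real.log_le_log (by positivity) ?_) (Real.log_nonneg ?_) (by linarith)
    · rw [div_le_iff₀ hδ]
      have : 1 ≤ 640 ^ 2 * δ := by
        rwa [div_le_iff₀' (by norm_num)] at hδs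
      nlinarith
    · rw [le_div_iff₀ hδ]; linarith
  have e2 : c ≤ Real.log (3 - 4 * δ₁) / (K * Real.log (K * 640 ^ 2) + 1) :=
    (min_le_right _ _).trans (min_le_right _ _)
  calc c * (k * Real.log (k / δ))
      ≤ Real.log (3 - 4 * δ₁) / (K * Real.log (K * 640 ^ 2) + 1) *
        (K * Real.log (K * 640 ^ 2) + 1) :=
        mul_le_mul e2 (by linarith) hL (by positivity)
    _ = Real.log (3 - 4 * δ₁) := div_mul_cancel₀ _ hK1.ne'
    _ ≤ Real.log (3 - 4 * δ) := Real.log_le_log (by linarith) (by linarith)
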